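/- **Setting.** Fix a first-order alphabet (function and predicate symbols with arities) and an infinite set of variables. A *query* is a finite sequence of atoms $A_1,\dots,A_n$; a *clause* $H\gets B$ consists of an atom $H$ and a query $B$; a *program* is a set of clauses. A *moding* assigns to each argument position of each predicate symbol a mode $+$ (input) or $-$ (output); a *3-moding* may also assign $\bot$ (neutral). A sequence of terms is *linear* if no variable occurs in it more than once. **Tidiness.** Let $M'$ be a moding. For a query $Q=A_1,\dots,A_n$ write $A_i\to_Q A_j$ if some variable occurs both in an output position of $A_i$ and in an input position of $A_j$. The query $Q$ is *tidy under* $M'$ if the sequence of the terms in all output positions of $Q$ is linear and $\to_Q$ is acyclic ($A_i\not\to_Q^+A_i$ for all $i$). A clause $H\gets B$ is *tidy under* $M'$ if $B$ is tidy, the sequence of the terms in the input positions of $H$ is linear, and no variable from an input position of $H$ occurs in an output position of $B$. A program $P$ is *weakly tidy under* $M,M'$, where $M$ is a 3-moding and $M'$ a moding, if for each clause $C\in P$ the clause obtained from $C$ by replacing the variables that occur in the $+$ positions (under $M$) of the head of $C$ by ground terms is tidy under $M'$. **SLD-resolution.** A (partial) *selection rule* assigns to each initial fragment of a derivation an occurrence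 of an atom in the last query of the fragment, or selects nothing. An SLD-derivation for $P$ with $Q$ under a selection rule starts with $Q$; if $A$ is selected in the last query $Q',A,Q''$, then the next query is $(Q',B,Q'')\theta$, where $H\gets B$ is a variant of a clause of $P$, standardized apart (variable disjoint from the initial and the last query and from the input clauses and substitutions used earlier), and $\theta$ is any most general unifier of $A$ and $H$. The queries of these derivations are the nodes of the SLD-tree for $P$ with $Q$. The selection rule is *compatible with* $M$ (for $P$ with $Q$) if, in the SLD-tree for $P$ with $Q$, (i) the $+$ positions (under $M$) of each selected atom are ground, and (ii) some atom is selected in each query that contains an atom whose $+$ positions are ground. **Unification without occur-check.** The Martelli–Montanari algorithm repeatedly applies to an arbitrarily chosen equation of the current set one of the following actions, until none is applicable: (1) replace $f(s_1,\dots,s_n)\doteq f(t_1,\dots,t_n)$ by $s_1\doteq t_1,\dots,s_n\doteq t_n$; (2) on $f(\dots)\doteq g(\dots)$ with $f\ne g$, halt with failure; (3) delete $X\doteq X$; (4) replace $t\doteq X$, where $t$ is not a variable, by $X\doteq t$; (5) if $X\doteq t$, $X\notin \mathrm{Var}(t)$ and $X$ occurs elsewhere, apply $\{X/t\}$ to all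 other equations; (6) on $X\doteq t$ with $X\in \mathrm{Var}(t)$, $X\neq t$, halt with failure. ($f,g$ are function symbols or predicate symbols.) A set of equations is *WNSTO* if there is a run (a maximal sequence of actions) on it in which action (6) is not performed. $P$ with $Q$ is *weakly occur-check free* under a selection rule if $\{A\doteq H\}$ is WNSTO whenever $A$ is the selected atom of a query of the SLD-tree for $P$ with $Q$, and $H$ is the head of a standardized apart variant of a clause of $P$ with the same predicate symbol as $A$. **Lemma.** Let $M$ be a 3-moding and $M'$ a moding, let $P$ be a program weakly tidy under $M,M'$, and let $Q$ be a query tidy under $M'$. Then under any selection rule compatible with $M$ (for $P$ with $Q$), 1. each query in any SLD-derivation for $P$ with $Q$ is tidy under $M'$, and 2. $P$ with $Q$ is weakly occur-check free. -/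

import Mathlib

universe u v w

namespace OccurCheck

variable {L : FirstOrder.Language.{u, v}} {V : Type w}

/-! ### Terms, atoms, queries, clauses

The alphabet is a first-order language `L` (function symbols `L.Functions n`, predicate symbols
`L.Relations n`), the variables are the elements of `V`, the terms are those of `L.Term V`. -/

/-- The list of all occurrences of variables in a term, from left to right. -/
def termOccs : L.Term V → List V
  | .var x => [x]
  | .func _ ts => (List.ofFn fun i => termOccs (ts i)).flatten

/-- `Var(t)` for a term `t`. -/
def termVars (t : L.Term V) : Set V := {x | x ∈ termOccs t}

/-- A term is ground when no variable occurs in it. -/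
def IsGround (t : L.Term V) : Prop := termVars t = ∅

/-- A sequence of terms is linear when no variable occurs in it more than once. -/
def LinearSeq (ts : List (L.Term V)) : Prop := (ts.flatMap termOccs).Nodup

variable (L V) in
/-- An atom `p(t₁,…,tₙ)`. -/
structure Atom where
  arity : ℕ
  pred : L.Relations arity
  args : Fin arity → L.Term V

/-- The predicate symbol of an atom (with its arity). -/
def Atom.symbol (A : Atom L V) : Σ n, L.Relations n := ⟨A.arity, A.pred⟩

def Atom.vars (A : Atom L V) : Set V := {x | ∃ i, x ∈ termVars (A.args i)}

variable (L V) in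
/-- A query is a finite sequence of atoms. -/
abbrev Query := List (Atom L V)

def queryVars (Q : Query L V) : Set V := {x | ∃ A ∈ Q, x ∈ A.vars}

variable (L V) in
/-- A definite clause `head ← body`. -/
structure Clause where
  head : Atom L V
  body : Query L V

def Clause.vars (C : Clause L V) : Set V := C.head.vars ∪ queryVars C.body

variable (L V) in
/-- A program is a set of definite clauses. -/
abbrev Program := Set (Clause L V)

/-! ### Substitutions -/

variable (L V) in
/-- A substitution, seen as a map on all variables that moves only finitely many of them. -/
structure Subst where
  map : V → L.Term V
  finite_dom : {x | map x ≠ .var x}.Finite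

/-- `Dom(θ) ∪ Ran(θ)`. -/
def Subst.vars (θ : Subst L V) : Set V :=
  {y | ∃ x, θ.map x ≠ .var x ∧ (y = x ∨ y ∈ termVars (θ.map x))}

/-- Application to an atom of a map from variables to terms. -/
def Atom.subst (A : Atom L V) (f : V → L.Term V) : Atom L V :=
  ⟨A.arity, A.pred, fun i => (A.args i).subst f⟩

def querySubst (Q : Query L V) (f : V → L.Term V) : Query L V := Q.map fun A => A.subst f

def Clause.subst (C : Clause L V) (f : V → L.Term V) : Clause L V :=
  ⟨C.head.subst f, querySubst C.body f⟩

/-- `θ` is a most general unifier of the atoms `A` and `B`: it unifies them, and each unifier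
`τ` of them is of the form `θη` for a substitution `η`. -/
def IsMGU (θ : Subst L V) (A B : Atom L V) : Prop :=
  A.subst θ.map = B.subst θ.map ∧
    ∀ τ : Subst L V, A.subst τ.map = B.subst τ.map →
      ∃ η : Subst L V, ∀ x, (θ.map x).subst η.map = τ.map x

/-- `C'` is obtained from `C` by renaming variables. -/
def IsVariant (C' C : Clause L V) : Prop :=
  ∃ ρ : Equiv.Perm V, C' = C.subst fun x => .var (ρ x)

/-! ### Modings -/

/-- The modes `+` (input) and `-` (output). -/
inductive Mode where
  | input
  | output
  deriving DecidableEq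

/-- The modes `+` (input), `-` (output) and `⊥` (neutral). -/
inductive Mode3 where
  | input
  | output
  | neutral
  deriving DecidableEq

variable (L) in
/-- A moding assigns a mode to each argument position of each predicate. -/
abbrev Moding := ∀ n : ℕ, L.Relations n → Fin n → Mode

variable (L) in
/-- A 3-moding: argument positions may also be neutral. -/
abbrev ThreeModing := ∀ n : ℕ, L.Relations n → Fin n → Mode3

/-- The sequence of the terms in the input positions of an atom. -/
def inTerms (M : Moding L) (A : Atom L V) : List (L.Term V) :=
  ((List.finRange A.arity).filter fun i => M A.arity A.pred i = .input).map A.args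

/-- The sequence of the terms in the output positions of an atom. -/
def outTerms (M : Moding L) (A : Atom L V) : List (L.Term V) :=
  ((List.finRange A.arity).filter fun i => M A.arity A.pred i = .output).map A.args

/-- The sequence of the terms in the input (`+`) positions of an atom, under a 3-moding. -/
def inTerms3 (M : ThreeModing L) (A : Atom L V) : List (L.Term V) :=
  ((List.finRange A.arity).filter fun i => M A.arity A.pred i = .input).map A.args

def varIn (M : Moding L) (A : Atom L V) : Set V := {x | ∃ t ∈ inTerms M A, x ∈ termVars t}

def varOut (M : Moding L) (A : Atom L V) : Set V := {x | ∃ t ∈ outTerms M A, x ∈ termVars t}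

def varIn3 (M : ThreeModing L) (A : Atom L V) : Set V :=
  {x | ∃ t ∈ inTerms3 M A, x ∈ termVars t}

/-- The input positions of `A` (under the 3-moding `M`) are ground. -/
def InputGround (M : ThreeModing L) (A : Atom L V) : Prop := ∀ t ∈ inTerms3 M A, IsGround t

/-! ### Tidy and weakly tidy -/

/-- The relation `→_Q` on the atoms of `Q`: a variable occurs in an output position of `A` and in
an input position of `B`. -/
def arrow (M : Moding L) (Q : Query L V) (A B : Atom L V) : Prop :=
  A ∈ Q ∧ B ∈ Q ∧ ∃ x, x ∈ varOut M A ∧ x ∈ varIn M B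

/-- A query is tidy when it is output linear and `→_Q` is acyclic. -/
def TidyQuery (M : Moding L) (Q : Query L V) : Prop :=
  LinearSeq (Q.flatMap (outTerms M)) ∧ ∀ A ∈ Q, ¬ Relation.TransGen (arrow M Q) A A

/-- A clause is tidy when its body is tidy, its head is input linear, and no variable from an
input position of the head occurs in an output position of the body. -/
def TidyClause (M : Moding L) (C : Clause L V) : Prop :=
  TidyQuery M C.body ∧ LinearSeq (inTerms M C.head) ∧
    ∀ x ∈ varIn M C.head, ∀ B ∈ C.body, x ∉ varOut M B

/-- `θ` grounds the variables that occur in the `+` positions of the head of `C` (under the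
3-moding `M`), and leaves all other variables unchanged. -/
def GroundsHeadInputs (M : ThreeModing L) (C : Clause L V) (θ : Subst L V) : Prop :=
  (∀ x ∈ varIn3 M C.head, IsGround (θ.map x)) ∧ ∀ x ∉ varIn3 M C.head, θ.map x = .var x

/-- `P` is weakly tidy under `M, M'`: the program obtained by grounding, in each clause, the
variables that occur in the `+` positions (under `M`) of its head is tidy under `M'`.
(Which ground terms are used is immaterial, as tidiness depends on variables only.) -/
def WeaklyTidy (M : ThreeModing L) (M' : Moding L) (P : Program L V) : Prop :=
  ∀ C ∈ P, ∃ θ : Subst L V, GroundsHeadInputs M C θ ∧ TidyClause M' (C.subst θ.map)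

/-! ### SLD-resolution -/

variable (L V) in
/-- The data of one resolution step: the position (counted from `0`) of the selected atom in the
query, the input clause, and the mgu. -/
structure SLDStep where
  pos : ℕ
  clause : Clause L V
  mgu : Subst L V

/-- Replace the atom at the given position by the body of the input clause, apply the mgu. -/
def resolvent (Q : Query L V) (s : SLDStep L V) : Query L V :=
  querySubst (Q.take s.pos ++ s.clause.body ++ Q.drop (s.pos + 1)) s.mgu.map

/-- An initial fragment of a derivation is given by its initial query `Q` and the list `h` of the
steps performed so far, the latest step first. This is its last query. -/
def lastQuery (Q : Query L V) : List (SLDStep L V) → Query L V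
  | [] => Q
  | s :: h => resolvent (lastQuery Q h) s

variable (L V) in
/-- A (partial) selection rule: given an initial fragment of a derivation, it selects
(an occurrence of) an atom in the last query, or selects nothing. -/
abbrev SelectionRule :=
  (Q : Query L V) → (h : List (SLDStep L V)) → Option (Fin (lastQuery Q h).length)

/-- The clause `C` is standardized apart with respect to the fragment `(Q, h)`: it is variable
disjoint from the initial query, from the last query, and from the input clauses and the
substitutions of the steps in `h`. -/
def StandardizedApart (Q : Query L V) (h : List (SLDStep L V)) (C : Clause L V) : Prop :=
  Disjoint C.vars (queryVars Q) ∧ Disjoint C.vars (queryVars (lastQuery Q h)) ∧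
    ∀ s ∈ h, Disjoint C.vars s.clause.vars ∧ Disjoint C.vars s.mgu.vars

/-- `C'` may serve as an input clause from `P` after the fragment `(Q, h)`: it is a standardized
apart variant of a clause of `P`. -/
def InputClause (P : Program L V) (Q : Query L V) (h : List (SLDStep L V))
    (C' : Clause L V) : Prop :=
  (∃ C ∈ P, IsVariant C' C) ∧ StandardizedApart Q h C'

/-- `(Q, h)` is an initial fragment of an SLD-derivation for `P` with `Q` via the selection
rule `R`. The queries of the SLD-derivations (finite or infinite) for `P` with `Q`, in other words
the nodes of the SLD-tree, are the last queries of such fragments. -/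
inductive Derivation (P : Program L V) (R : SelectionRule L V) (Q : Query L V) :
    List (SLDStep L V) → Prop
  | nil : Derivation P R Q []
  | cons (h : List (SLDStep L V)) (i : Fin (lastQuery Q h).length) (C : Clause L V)
      (θ : Subst L V) : Derivation P R Q h → R Q h = some i → InputClause P Q h C →
      IsMGU θ ((lastQuery Q h).get i) C.head → Derivation P R Q (⟨i, C, θ⟩ :: h)

/-- The selection rule `R` is compatible with the 3-moding `M` for `P` with `Q`:
the input positions are ground in each selected atom, and some atom is selected in a query
whenever the query contains an atom with its input positions ground. -/
def Compatible (M : ThreeModing L) (P : Program L V) (Q : Query L V)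
    (R : SelectionRule L V) : Prop :=
  ∀ h, Derivation P R Q h →
    (∀ i, R Q h = some i → InputGround M ((lastQuery Q h).get i)) ∧
    ((∃ A ∈ lastQuery Q h, InputGround M A) → ∃ i, R Q h = some i)

/-! ### The Martelli-Montanari algorithm, WNSTO -/

variable (L V) in
/-- Equations between terms, and between atoms. -/
inductive Equation where
  | term (s t : L.Term V)
  | atom (A B : Atom L V)

def Equation.vars : Equation L V → Set V
  | .term s t => termVars s ∪ termVars t
  | .atom A B => A.vars ∪ B.vars

def Equation.subst (f : V → L.Term V) : Equation L V → Equation L V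
  | .term s t => .term (s.subst f) (t.subst f)
  | .atom A B => .atom (A.subst f) (B.subst f)

open Classical in
/-- The map given by the substitution `{X/t}`. -/
noncomputable def single (X : V) (t : L.Term V) : V → L.Term V :=
  Function.update (fun x => .var x) X t

def IsVar (t : L.Term V) : Prop := ∃ x, t = .var x

/-- The actions of the algorithm that do not halt: decomposition (of an equation between terms, or
between atoms), deletion of `X ≐ X`, reorientation, variable elimination. -/
inductive MMAStep : Set (Equation L V) → Set (Equation L V) → Prop
  | decomposeTerm (E : Set (Equation L V)) (n : ℕ) (f : L.Functions n) (s t : Fin n → L.Term V) :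
      .term (.func f s) (.func f t) ∈ E →
      MMAStep E ((E \ {.term (.func f s) (.func f t)}) ∪ Set.range fun i => .term (s i) (t i))
  | decomposeAtom (E : Set (Equation L V)) (n : ℕ) (p : L.Relations n) (s t : Fin n → L.Term V) :
      .atom ⟨n, p, s⟩ ⟨n, p, t⟩ ∈ E →
      MMAStep E ((E \ {.atom ⟨n, p, s⟩ ⟨n, p, t⟩}) ∪ Set.range fun i => .term (s i) (t i))
  | delete (E : Set (Equation L V)) (X : V) : .term (.var X) (.var X) ∈ E →
      MMAStep E (E \ {.term (.var X) (.var X)})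
  | orient (E : Set (Equation L V)) (t : L.Term V) (X : V) : .term t (.var X) ∈ E → ¬ IsVar t →
      MMAStep E ((E \ {.term t (.var X)}) ∪ {.term (.var X) t})
  | eliminate (E : Set (Equation L V)) (X : V) (t : L.Term V) :
      .term (.var X) t ∈ E → X ∉ termVars t →
      (∃ e ∈ E \ {.term (.var X) t}, X ∈ e.vars) →
      MMAStep E (Equation.subst (single X t) '' (E \ {.term (.var X) t}) ∪ {.term (.var X) t})

/-- The action that halts with failure on distinct function (or predicate) symbols is applicable. -/
def Clash (E : Set (Equation L V)) : Prop :=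
  (∃ (m n : ℕ) (f : L.Functions m) (g : L.Functions n) (s : Fin m → L.Term V)
      (t : Fin n → L.Term V), (⟨m, f⟩ : Σ k, L.Functions k) ≠ ⟨n, g⟩ ∧
      .term (.func f s) (.func g t) ∈ E) ∨
    ∃ A B : Atom L V, A.symbol ≠ B.symbol ∧ .atom A B ∈ E

/-- The action that halts with failure on a successful occur-check is applicable. -/
def OccurFailure (E : Set (Equation L V)) : Prop :=
  ∃ (X : V) (t : L.Term V), X ∈ termVars t ∧ t ≠ .var X ∧ .term (.var X) t ∈ E

/-- No action is applicable. -/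
def Final (E : Set (Equation L V)) : Prop :=
  (∀ E', ¬ MMAStep E E') ∧ ¬ Clash E ∧ ¬ OccurFailure E

/-- `E` is WNSTO: there is a run of the algorithm on `E` (a maximal sequence of actions) in which
the occur-check action is not performed. Such a run consists of non-halting actions leading from `E`
to some `E'`, after which either the algorithm halts on a clash of symbols, or no action is
applicable. -/
def WNSTO (E : Set (Equation L V)) : Prop :=
  ∃ E', Relation.ReflTransGen MMAStep E E' ∧ (Clash E' ∨ Final E')

/-- The unification `{A ≐ H}` is available in the SLD-tree for `P` with `Q` via `R`:
`A` is the selected atom of a query in the tree, `H` is the head of a standardized apart variant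
of a clause of `P`, and `A`, `H` have the same predicate symbol. -/
def Available (P : Program L V) (R : SelectionRule L V) (Q : Query L V) (A H : Atom L V) : Prop :=
  ∃ (h : List (SLDStep L V)) (i : Fin (lastQuery Q h).length) (C : Clause L V),
    Derivation P R Q h ∧ R Q h = some i ∧ InputClause P Q h C ∧
    A = (lastQuery Q h).get i ∧ H = C.head ∧ A.symbol = H.symbol

/-- `P` with `Q` is weakly occur-check free under the selection rule `R`. -/
def WeaklyOccurCheckFree (P : Program L V) (R : SelectionRule L V) (Q : Query L V) : Prop :=
  ∀ A H, Available P R Q A H → WNSTO {.atom A H}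

end OccurCheck

/-!
Orient the equations `a ≐ h` between the arguments of a selected atom and of a head: in an input
position `h` is the output and `a` the input of the equation, in an output position conversely. If
`Q₁, A, Q₂` and the standardized apart clause `H ← B` are tidy, then so is the system that consists
of the oriented equations for `A ≐ H` and the atoms of `Q₁, B, Q₂`, where an equation contributes to
the data flow like an atom. In a tidy system, an equation between a variable `X` and a term `t` has
`X ∉ Var(t)`, as data do not flow in circles; elimination of `X` yields a tidy system again, and so
does decomposition. Hence no occur-check is needed, and unless a clash occurs, a tidy query is left.
The resolvent for another mgu is a renaming of this query.

For a weakly tidy clause, the equations in the `+` positions of the head are solved first. They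
match terms against ground terms, so again no occur-check is needed, and a solution grounds the
variables in the `+` positions of the head, which makes the clause tidy.
-/

namespace OccurCheck

section Nodes

variable {V : Type*} {V' : Type*}

/-- The occurrences of variables in the output part and in the input part of an atom, or of an
equation one of whose sides is regarded as output and the other one as input. -/
structure IONode (V : Type*) where
  out : List V
  inp : List V

/-- The variables of a list of nodes. -/
def nodeVars (N : List (IONode V)) : Set V := {x | ∃ n ∈ N, x ∈ n.out ∨ x ∈ n.inp}

/-- Replacement of each occurrence of a variable `x` by the sequence `f x`. -/
def IONode.bind (f : V → List V') (n : IONode V) : IONode V' :=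
  ⟨n.out.flatMap f, n.inp.flatMap f⟩

/-- Data flow between variables: some node has `x` in its input part and `y` in its output part. -/
def Flow (N : List (IONode V)) (x y : V) : Prop := ∃ n ∈ N, x ∈ n.inp ∧ y ∈ n.out

/-- Tidiness of a list of nodes: output linearity, and acyclicity of the data flow. Acyclicity is
expressed on variables rather than on nodes, so that it is stable under splitting nodes. -/
structure TidyNodes (N : List (IONode V)) : Prop where
  nodup : (N.flatMap IONode.out).Nodup
  acyclic : ∀ x, ¬ Relation.TransGen (Flow N) x x

theorem mem_nodeVars_of_mem_out {N : List (IONode V)} {x : V}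
    (hx : x ∈ N.flatMap IONode.out) : x ∈ nodeVars N :=
  have ⟨n, hn, hx⟩ := List.mem_flatMap.1 hx
  ⟨n, hn, .inl hx⟩

theorem flatMap_out_map_bind (f : V → List V') (N : List (IONode V)) :
    (N.map (IONode.bind f)).flatMap IONode.out = (N.flatMap IONode.out).flatMap f := by
  simp only [List.flatMap_map, List.flatMap_assoc, IONode.bind]

theorem flow_map_bind {f : V → List V'} {N : List (IONode V)} {x y : V'} :
    Flow (N.map (IONode.bind f)) x y ↔ ∃ x₀ y₀, Flow N x₀ y₀ ∧ x ∈ f x₀ ∧ y ∈ f y₀ := by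
  constructor
  · rintro ⟨_, hn, hx, hy⟩
    obtain ⟨n, hnN, rfl⟩ := List.mem_map.1 hn
    obtain ⟨x₀, hx₀, hx⟩ := List.mem_flatMap.1 hx
    obtain ⟨y₀, hy₀, hy⟩ := List.mem_flatMap.1 hy
    exact ⟨x₀, y₀, ⟨n, hnN, hx₀, hy₀⟩, hx, hy⟩
  · rintro ⟨x₀, y₀, ⟨n, hn, hx₀, hy₀⟩, hx, hy⟩
    exact ⟨n.bind f, List.mem_map_of_mem hn, List.mem_flatMap_of_mem hx₀ hx,
      List.mem_flatMap_of_mem hy₀ hy⟩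

theorem flatMap_sublist_self {f : V → List V} (hf : ∀ x, (f x).Sublist [x]) :
    ∀ l : List V, (l.flatMap f).Sublist l
  | [] => .slnil
  | x :: l => (hf x).append (flatMap_sublist_self hf l)

theorem nodup_flatMap_of_disjoint {l T : List V} {X : V} {f : V → List V} (hl : l.Nodup)
    (hT : T.Nodup) (hdis : T.Disjoint l) (hX : f X = T) (hf : ∀ x, x ≠ X → f x = [x]) :
    (l.flatMap f).Nodup := by
  have hmem {x z : V} (hz : z ∈ f x) : x = X ∧ z ∈ T ∨ z = x := by
    obtain rfl | hne := eq_or_ne x X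
    exacts [.inl ⟨rfl, hX ▸ hz⟩, .inr (List.mem_singleton.1 (hf x hne ▸ hz))]
  refine List.nodup_flatMap.2 ⟨fun x _ => ?_, hl.imp_of_mem fun {x y} hx hy hxy z hzx hzy => ?_⟩
  · obtain rfl | hne := eq_or_ne x X
    exacts [hX ▸ hT, hf x hne ▸ List.nodup_singleton x]
  · rcases hmem hzx with ⟨rfl, hzT⟩ | rfl <;> rcases hmem hzy with ⟨rfl, hzT'⟩ | rfl
    exacts [hxy rfl, hdis hzT hy, hdis hzT' hx, hxy rfl]

namespace TidyNodes

theorem exists_rank {N : List (IONode V)} (hN : TidyNodes N) :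
    ∃ r : V → ℕ, ∀ x y, Flow N x y → r x < r y := by
  classical
  let vars : Finset V := (N.flatMap IONode.inp).toFinset
  refine ⟨fun x => (vars.filter fun z => Relation.TransGen (Flow N) z x).card, fun x y hxy =>
    Finset.card_lt_card ((Finset.ssubset_iff_of_subset ?_).2 ⟨x, ?_, ?_⟩)⟩
  · exact Finset.monotone_filter_right _ fun z _ hz => hz.tail hxy
  · have ⟨n, hn, hx, _⟩ := hxy
    exact Finset.mem_filter.2
      ⟨List.mem_toFinset.2 (List.mem_flatMap_of_mem hn hx), .single hxy⟩
  · exact fun hx => hN.acyclic x (Finset.mem_filter.1 hx).2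

theorem of_rank {α : Type*} [Preorder α] {N : List (IONode V)}
    (hN : (N.flatMap IONode.out).Nodup) (r : V → α) (hr : ∀ x y, Flow N x y → r x < r y) :
    TidyNodes N :=
  ⟨hN, fun x hx => lt_irrefl (r x) <| by
    simpa only [Relation.transGen_eq_self] using hx.lift r hr⟩

theorem of_flow_le {N N' : List (IONode V)} (hN : TidyNodes N)
    (hN' : (N'.flatMap IONode.out).Nodup) (h : Flow N' ≤ Flow N) : TidyNodes N' :=
  ⟨hN', fun x hx => hN.acyclic x (Relation.TransGen.mono h x x hx)⟩

theorem of_sublist {N N' : List (IONode V)} (hN : TidyNodes N) (h : N'.Sublist N) :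
    TidyNodes N' :=
  hN.of_flow_le (hN.nodup.sublist (h.flatMap _))
    fun _ _ ⟨n, hn, hxy⟩ => ⟨n, h.subset hn, hxy⟩

theorem of_perm {N N' : List (IONode V)} (hN : TidyNodes N) (h : N'.Perm N) : TidyNodes N' :=
  hN.of_flow_le ((h.flatMap_right _).nodup_iff.2 hN.nodup)
    fun _ _ ⟨n, hn, hxy⟩ => ⟨n, h.subset hn, hxy⟩

theorem bind_of_sublist {N : List (IONode V)} (hN : TidyNodes N) {f : V → List V}
    (hf : ∀ x, (f x).Sublist [x]) : TidyNodes (N.map (IONode.bind f)) := by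
  refine hN.of_flow_le ?_ fun x y hxy => ?_
  · exact flatMap_out_map_bind f N ▸ hN.nodup.sublist (flatMap_sublist_self hf _)
  · obtain ⟨x₀, y₀, hflow, hx, hy⟩ := flow_map_bind.1 hxy
    rw [List.mem_singleton.1 ((hf x₀).subset hx), List.mem_singleton.1 ((hf y₀).subset hy)]
    exact hflow

theorem rename {N : List (IONode V)} (hN : TidyNodes N) {ρ : V → V'}
    (hρ : Set.InjOn ρ (nodeVars N)) : TidyNodes (N.map (IONode.bind fun x => [ρ x])) := by
  have hflow {x y : V'} (hxy : Flow (N.map (IONode.bind fun x => [ρ x])) x y) :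
      ∃ x₀ ∈ nodeVars N, ∃ y₀ ∈ nodeVars N, Flow N x₀ y₀ ∧ x = ρ x₀ ∧ y = ρ y₀ := by
    obtain ⟨x₀, y₀, ⟨n, hn, hx₀, hy₀⟩, hx, hy⟩ := flow_map_bind.1 hxy
    exact ⟨x₀, ⟨n, hn, .inr hx₀⟩, y₀, ⟨n, hn, .inl hy₀⟩, ⟨n, hn, hx₀, hy₀⟩,
      List.mem_singleton.1 hx, List.mem_singleton.1 hy⟩
  have hpath {x y : V'} (hxy : Relation.TransGen (Flow (N.map (IONode.bind fun x => [ρ x]))) x y) :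
      ∃ x₀ ∈ nodeVars N, ∃ y₀ ∈ nodeVars N,
        Relation.TransGen (Flow N) x₀ y₀ ∧ x = ρ x₀ ∧ y = ρ y₀ := by
    induction hxy with
    | single hxy =>
      obtain ⟨x₀, hx₀, y₀, hy₀, h, hx, hy⟩ := hflow hxy
      exact ⟨x₀, hx₀, y₀, hy₀, .single h, hx, hy⟩
    | tail _ hyz ih =>
      obtain ⟨x₀, hx₀, y₀, hy₀, h, hx, hy⟩ := ih
      obtain ⟨y₁, hy₁, z₀, hz₀, h', hy', hz⟩ := hflow hyz
      obtain rfl : y₀ = y₁ := hρ hy₀ hy₁ (hy.symm.trans hy')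
      exact ⟨x₀, hx₀, z₀, hz₀, h.tail h', hx, hz⟩
  refine ⟨?_, fun x hx => ?_⟩
  · rw [flatMap_out_map_bind, ← List.map_eq_flatMap]
    exact hN.nodup.map_on fun x hx y hy =>
      hρ (mem_nodeVars_of_mem_out hx) (mem_nodeVars_of_mem_out hy)
  · obtain ⟨x₀, hx₀, y₀, hy₀, h, hxx, hxy⟩ := hpath hx
    obtain rfl : x₀ = y₀ := hρ hx₀ hy₀ (hxx.symm.trans hxy)
    exact hN.acyclic x₀ h

theorem split {ι : Type*} {N : List (IONode V)} {l : List ι} {o i : ι → List V}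
    (hN : TidyNodes (⟨l.flatMap o, l.flatMap i⟩ :: N)) :
    TidyNodes (l.map (fun j => ⟨o j, i j⟩) ++ N) := by
  refine hN.of_flow_le ?_ ?_
  · simpa only [List.flatMap_append, List.flatMap_map, List.flatMap_cons] using hN.nodup
  · rintro x y ⟨n, hn, hx, hy⟩
    rcases List.mem_append.1 hn with hn | hn
    · obtain ⟨j, hj, rfl⟩ := List.mem_map.1 hn
      exact ⟨_, List.mem_cons_self, List.mem_flatMap_of_mem hj hx, List.mem_flatMap_of_mem hj hy⟩
    · exact ⟨n, List.mem_cons_of_mem _ hn, hx, hy⟩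

theorem eliminate_out {N : List (IONode V)} {X : V} {T : List V}
    (hN : TidyNodes (⟨[X], T⟩ :: N)) {f : V → List V} (hX : f X = T)
    (hf : ∀ x, x ≠ X → f x = [x]) : TidyNodes (N.map (IONode.bind f)) := by
  have hnodup : X ∉ N.flatMap IONode.out ∧ (N.flatMap IONode.out).Nodup := by
    simpa only [List.flatMap_cons, List.singleton_append, List.nodup_cons] using hN.nodup
  have hout {y : V} (hy : y ∈ N.flatMap IONode.out) : f y = [y] :=
    hf y fun hyX => hnodup.1 (hyX ▸ hy)
  obtain ⟨r, hr⟩ := hN.exists_rank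
  refine of_rank ?_ r fun x y hxy => ?_
  · rw [flatMap_out_map_bind, List.flatMap_congr fun y hy => hout hy, List.flatMap_singleton']
    exact hnodup.2
  · obtain ⟨x₀, y₀, ⟨n, hn, hx₀, hy₀⟩, hx, hy⟩ := flow_map_bind.1 hxy
    rw [hout (List.mem_flatMap_of_mem hn hy₀), List.mem_singleton] at hy
    have hlt : r x₀ < r y := hy ▸ hr _ _ ⟨n, List.mem_cons_of_mem _ hn, hx₀, hy₀⟩
    obtain rfl | hne := eq_or_ne x₀ X
    · exact (hr x x₀ ⟨_, List.mem_cons_self, hX ▸ hx, List.mem_singleton_self x₀⟩).trans hlt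
    · rw [hf x₀ hne, List.mem_singleton] at hx
      exact hx ▸ hlt

theorem eliminate_in {N : List (IONode V)} {X : V} {T : List V}
    (hN : TidyNodes (⟨T, [X]⟩ :: N)) {f : V → List V} (hX : f X = T)
    (hf : ∀ x, x ≠ X → f x = [x]) : TidyNodes (N.map (IONode.bind f)) := by
  classical
  obtain ⟨hT, hout, hdis⟩ := List.nodup_append'.1 (List.flatMap_cons ▸ hN.nodup)
  obtain ⟨r, hr⟩ := hN.exists_rank
  have hXT {y : V} (hy : y ∈ T) : r X < r y :=
    hr X y ⟨_, List.mem_cons_self, List.mem_singleton_self X, hy⟩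
  -- The variables of `T` now stand for `X`, so they take over its rank.
  let s : V → ℕ := fun y => if y ∈ T then r X else r y
  have hs_le {x x₀ : V} (hx : x ∈ f x₀) : s x ≤ r x₀ := by
    obtain rfl | hne := eq_or_ne x₀ X
    · exact (if_pos (hX ▸ hx : x ∈ T)).le
    · obtain rfl : x = x₀ := List.mem_singleton.1 (hf x₀ hne ▸ hx)
      dsimp only [s]
      split_ifs with hxT
      exacts [(hXT hxT).le, le_rfl]
  have hs_eq {y y₀ : V} (hy₀ : y₀ ∈ N.flatMap IONode.out) (hy : y ∈ f y₀) : s y = r y₀ := by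
    obtain rfl | hne := eq_or_ne y₀ X
    · exact if_pos (hX ▸ hy : y ∈ T)
    · obtain rfl : y = y₀ := List.mem_singleton.1 (hf y₀ hne ▸ hy)
      exact if_neg fun hyT => hdis hyT hy₀
  refine of_rank ?_ s fun x y hxy => ?_
  · rw [flatMap_out_map_bind]
    exact nodup_flatMap_of_disjoint hout hT hdis hX hf
  · obtain ⟨x₀, y₀, ⟨n, hn, hx₀, hy₀⟩, hx, hy⟩ := flow_map_bind.1 hxy
    rw [hs_eq (List.mem_flatMap_of_mem hn hy₀) hy]
    exact (hs_le hx).trans_lt (hr x₀ y₀ ⟨n, List.mem_cons_of_mem _ hn, hx₀, hy₀⟩)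

theorem nodup_out_resolve {N₁ N₂ NB : List (IONode V)} {o i o' i' : List V}
    (hN : TidyNodes (N₁ ++ ⟨o, i⟩ :: N₂)) (hB : TidyNodes (⟨i', []⟩ :: ⟨[], o'⟩ :: NB))
    (hdis : Disjoint (nodeVars (N₁ ++ ⟨o, i⟩ :: N₂)) (nodeVars (⟨i', []⟩ :: ⟨[], o'⟩ :: NB))) :
    ((⟨i', i⟩ :: ⟨o, o'⟩ :: (N₁ ++ NB ++ N₂)).flatMap IONode.out).Nodup := by
  have hperm : List.Perm ((⟨i', i⟩ :: ⟨o, o'⟩ :: (N₁ ++ NB ++ N₂)).flatMap IONode.out)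
      ((N₁ ++ ⟨o, i⟩ :: N₂).flatMap IONode.out ++
        (⟨i', []⟩ :: ⟨[], o'⟩ :: NB).flatMap IONode.out) := by
    classical
    simp only [List.perm_iff_count, List.flatMap_append, List.flatMap_cons, List.count_append,
      List.count_nil]
    omega
  exact hperm.nodup_iff.2 (List.nodup_append'.2 ⟨hN.nodup, hB.nodup, fun x hx hx' =>
    Set.disjoint_left.1 hdis (mem_nodeVars_of_mem_out hx) (mem_nodeVars_of_mem_out hx')⟩)

/- The variables of the clause are ranked between the variables of `i` and those of `o`; hence the
lexicographic order, with doubled query ranks to make room. -/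
theorem resolve {N₁ N₂ NB : List (IONode V)} {o i o' i' : List V}
    (hN : TidyNodes (N₁ ++ ⟨o, i⟩ :: N₂)) (hB : TidyNodes (⟨i', []⟩ :: ⟨[], o'⟩ :: NB))
    (hdis : Disjoint (nodeVars (N₁ ++ ⟨o, i⟩ :: N₂)) (nodeVars (⟨i', []⟩ :: ⟨[], o'⟩ :: NB))) :
    TidyNodes (⟨i', i⟩ :: ⟨o, o'⟩ :: (N₁ ++ NB ++ N₂)) := by
  classical
  obtain ⟨rN, hrN⟩ := hN.exists_rank
  obtain ⟨rB, hrB⟩ := hB.exists_rank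
  let m : ℕ := i.toFinset.sup fun x => rN x + 1
  let r (x : V) : ℕ ×ₗ ℕ :=
    toLex (if x ∈ nodeVars (⟨i', []⟩ :: ⟨[], o'⟩ :: NB) then (2 * m, rB x) else (2 * rN x + 1, 0))
  have hr_clause {n : IONode V} (hn : n ∈ (⟨i', []⟩ :: ⟨[], o'⟩ :: NB : List (IONode V))) {x : V}
      (hx : x ∈ n.out ∨ x ∈ n.inp) : r x = toLex (2 * m, rB x) :=
    congrArg toLex (if_pos ⟨n, hn, hx⟩)
  have hr_query {n : IONode V} (hn : n ∈ N₁ ++ ⟨o, i⟩ :: N₂) {x : V}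
      (hx : x ∈ n.out ∨ x ∈ n.inp) : r x = toLex (2 * rN x + 1, 0) :=
    congrArg toLex (if_neg (Set.disjoint_left.1 hdis ⟨n, hn, hx⟩))
  have hoi : (⟨o, i⟩ : IONode V) ∈ N₁ ++ ⟨o, i⟩ :: N₂ := by simp
  have hr_flow_query {n : IONode V} (hn : n ∈ N₁ ++ ⟨o, i⟩ :: N₂) {x y : V} (hx : x ∈ n.inp)
      (hy : y ∈ n.out) : r x < r y := by
    rw [hr_query hn (.inr hx), hr_query hn (.inl hy), Prod.Lex.toLex_lt_toLex]
    have := hrN x y ⟨n, hn, hx, hy⟩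
    exact .inl (by dsimp only; omega)
  refine of_rank (nodup_out_resolve hN hB hdis) r ?_
  rintro x y ⟨n, hn, hx, hy⟩
  simp only [List.mem_cons, List.mem_append] at hn
  rcases hn with rfl | rfl | (hn | hn) | hn
  · rw [hr_query hoi (.inr hx), hr_clause List.mem_cons_self (.inl hy), Prod.Lex.toLex_lt_toLex]
    have : rN x + 1 ≤ m := Finset.le_sup (f := fun x => rN x + 1) (List.mem_toFinset.2 hx)
    exact .inl (by dsimp only; omega)
  · rw [hr_clause (List.mem_cons_of_mem _ List.mem_cons_self) (.inr hx), hr_query hoi (.inl hy),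
      Prod.Lex.toLex_lt_toLex]
    have : m ≤ rN y := Finset.sup_le fun z hz => hrN z y ⟨_, hoi, List.mem_toFinset.1 hz, hy⟩
    exact .inl (by dsimp only; omega)
  · exact hr_flow_query (by simp only [List.mem_append, hn, true_or]) hx hy
  · have hn' := List.mem_cons_of_mem (⟨i', []⟩ : IONode V) (List.mem_cons_of_mem ⟨[], o'⟩ hn)
    rw [hr_clause hn' (.inr hx), hr_clause hn' (.inl hy), Prod.Lex.toLex_lt_toLex]
    exact .inr ⟨rfl, hrB x y ⟨n, hn', hx, hy⟩⟩
  · exact hr_flow_query (by simp only [List.mem_append, List.mem_cons, hn, or_true]) hx hy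

end TidyNodes
end Nodes

variable {L : FirstOrder.Language.{u, v}} {V : Type w}

theorem mem_termVars {x : V} {t : L.Term V} : x ∈ termVars t ↔ x ∈ termOccs t := Iff.rfl

theorem termOccs_var (x : V) : termOccs (.var x : L.Term V) = [x] := by rw [termOccs]

theorem termOccs_func {n : ℕ} (f : L.Functions n) (ts : Fin n → L.Term V) :
    termOccs (.func f ts) = (List.finRange n).flatMap fun i => termOccs (ts i) := by
  rw [termOccs, List.ofFn_eq_map, List.flatMap_def]

theorem mem_termVars_var {x y : V} : x ∈ termVars (.var y : L.Term V) ↔ x = y := by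
  rw [mem_termVars, termOccs_var, List.mem_singleton]

theorem mem_termVars_func {n : ℕ} {f : L.Functions n} {ts : Fin n → L.Term V} {x : V} :
    x ∈ termVars (.func f ts) ↔ ∃ i, x ∈ termVars (ts i) := by
  simp only [mem_termVars, termOccs_func, List.mem_flatMap, List.mem_finRange, true_and]

theorem isGround_iff {t : L.Term V} : IsGround t ↔ termOccs t = [] := by
  rw [IsGround, Set.eq_empty_iff_forall_notMem, List.eq_nil_iff_forall_not_mem]
  rfl

theorem termOccs_subst (t : L.Term V) (f : V → L.Term V) :
    termOccs (t.subst f) = (termOccs t).flatMap fun x => termOccs (f x) := by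
  induction t with
  | var x => rw [termOccs_var, List.flatMap_singleton, FirstOrder.Language.Term.subst]
  | func g ts ih =>
    simp only [FirstOrder.Language.Term.subst, termOccs_func, ih, List.flatMap_assoc]

theorem mem_termVars_subst {t : L.Term V} {f : V → L.Term V} {y : V} :
    y ∈ termVars (t.subst f) ↔ ∃ x ∈ termVars t, y ∈ termVars (f x) := by
  simp only [mem_termVars, termOccs_subst, List.mem_flatMap]

theorem subst_congr {t : L.Term V} {f g : V → L.Term V} (h : ∀ x ∈ termVars t, f x = g x) :
    t.subst f = t.subst g := by
  induction t with
  | var x => exact h x (mem_termVars_var.2 rfl)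
  | func k ts ih =>
    exact congrArg (FirstOrder.Language.Term.func k) <|
      funext fun i => ih i fun x hx => h x (mem_termVars_func.2 ⟨i, hx⟩)

theorem subst_var (t : L.Term V) : t.subst .var = t := by
  induction t with
  | var x => rfl
  | func k ts ih => simp only [FirstOrder.Language.Term.subst, ih]

theorem subst_subst (t : L.Term V) (f g : V → L.Term V) :
    (t.subst f).subst g = t.subst fun x => (f x).subst g := by
  induction t with
  | var x => rfl
  | func k ts ih => simp only [FirstOrder.Language.Term.subst, ih]

theorem subst_eq_self_iff {t : L.Term V} {f : V → L.Term V} :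
    t.subst f = t ↔ ∀ x ∈ termVars t, f x = .var x := by
  refine ⟨fun h => ?_, fun h => (subst_congr h).trans (subst_var t)⟩
  induction t with
  | var y =>
    intro x hx
    exact mem_termVars_var.1 hx ▸ h
  | func k ts ih =>
    intro x hx
    obtain ⟨i, hx⟩ := mem_termVars_func.1 hx
    obtain ⟨-, -, hargs⟩ := FirstOrder.Language.Term.func.inj h
    exact ih i (congrFun (eq_of_heq hargs) i) x hx

theorem IsGround.subst_eq {t : L.Term V} (ht : IsGround t) (f : V → L.Term V) :
    t.subst f = t :=
  subst_eq_self_iff.2 fun x hx => absurd (ht ▸ hx : x ∈ (∅ : Set V)) (Set.notMem_empty x)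

theorem IsGround.subst {t : L.Term V} (ht : IsGround t) (f : V → L.Term V) :
    IsGround (t.subst f) :=
  (ht.subst_eq f).symm ▸ ht

theorem isGround_subst_iff {t : L.Term V} {f : V → L.Term V} :
    IsGround (t.subst f) ↔ ∀ x ∈ termVars t, IsGround (f x) := by
  simp only [isGround_iff, termOccs_subst, List.flatMap_eq_nil_iff, mem_termVars]

theorem IsGround.args {n : ℕ} {f : L.Functions n} {ts : Fin n → L.Term V}
    (h : IsGround (.func f ts)) (i : Fin n) : IsGround (ts i) := by
  rw [isGround_iff, termOccs_func, List.flatMap_eq_nil_iff] at h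
  exact isGround_iff.2 (h i (List.mem_finRange i))

/-- A map from variables to terms that only grounds variables; the result of matching against
ground terms. -/
def IsPartialGrounding (f : V → L.Term V) : Prop := ∀ x, f x = .var x ∨ IsGround (f x)

theorem IsPartialGrounding.termOccs_sublist {f : V → L.Term V} (hf : IsPartialGrounding f) (x : V) :
    (termOccs (f x)).Sublist [x] := by
  rcases hf x with h | h
  · rw [h, termOccs_var]
  · exact isGround_iff.1 h ▸ List.nil_sublist _

theorem IsPartialGrounding.comp {f g : V → L.Term V} (hf : IsPartialGrounding f)
    (hg : IsPartialGrounding g) : IsPartialGrounding fun x => (f x).subst g := by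
  intro x
  obtain h | h := hf x
  · simpa only [h, FirstOrder.Language.Term.subst] using hg x
  · exact .inr (h.subst g)

theorem single_same (X : V) (t : L.Term V) : single X t X = t := by
  simp only [single, Function.update_self]

theorem single_of_ne {X x : V} (t : L.Term V) (h : x ≠ X) : single X t x = .var x := by
  classical exact Function.update_of_ne h _ _

theorem isPartialGrounding_single {X : V} {t : L.Term V} (ht : IsGround t) :
    IsPartialGrounding (single X t) := by
  intro x
  obtain rfl | hne := eq_or_ne x X
  · exact .inr (by rwa [single_same])
  · exact .inl (single_of_ne t hne)

theorem termOccs_single_of_ne {X x : V} (t : L.Term V) (hx : x ≠ X) :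
    termOccs (single X t x) = [x] := by
  rw [single_of_ne t hx, termOccs_var]

theorem eq_or_mem_of_mem_termVars_single {X x y : V} {t : L.Term V}
    (hy : y ∈ termVars (single X t x)) : x = X ∧ y ∈ termVars t ∨ x ≠ X ∧ y = x := by
  obtain rfl | hne := eq_or_ne x X
  · exact .inl ⟨rfl, single_same x t ▸ hy⟩
  · exact .inr ⟨hne, mem_termVars_var.1 (single_of_ne t hne ▸ hy)⟩

theorem subst_single_eq_self {X : V} {t s : L.Term V} (h : X ∉ termVars s) :
    s.subst (single X t) = s :=
  subst_eq_self_iff.2 fun _ hx => single_of_ne t fun hxX => h (hxX ▸ hx)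

/-! ### Atoms, queries and clauses as nodes -/

theorem Atom.subst_congr {A : Atom L V} {f g : V → L.Term V} (h : ∀ x ∈ A.vars, f x = g x) :
    A.subst f = A.subst g :=
  congrArg (Atom.mk A.arity A.pred) <|
    funext fun i => OccurCheck.subst_congr fun x hx => h x ⟨i, hx⟩

theorem Atom.subst_var (A : Atom L V) : A.subst .var = A :=
  congrArg (Atom.mk A.arity A.pred) <| funext fun i => OccurCheck.subst_var (A.args i)

theorem Atom.subst_subst (A : Atom L V) (f g : V → L.Term V) :
    (A.subst f).subst g = A.subst fun x => (f x).subst g :=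
  congrArg (Atom.mk A.arity A.pred) <| funext fun i => OccurCheck.subst_subst (A.args i) f g

theorem Atom.mem_vars_subst {A : Atom L V} {f : V → L.Term V} {y : V} :
    y ∈ (A.subst f).vars ↔ ∃ x ∈ A.vars, y ∈ termVars (f x) := by
  constructor
  · rintro ⟨i, hi⟩
    obtain ⟨x, hx, hy⟩ := mem_termVars_subst.1 hi
    exact ⟨x, ⟨i, hx⟩, hy⟩
  · rintro ⟨x, ⟨i, hx⟩, hy⟩
    exact ⟨i, mem_termVars_subst.2 ⟨x, hx, hy⟩⟩

theorem querySubst_congr {Q : Query L V} {f g : V → L.Term V}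
    (h : ∀ x ∈ queryVars Q, f x = g x) : querySubst Q f = querySubst Q g :=
  List.map_congr_left fun A hA => Atom.subst_congr fun x hx => h x ⟨A, hA, hx⟩

theorem querySubst_var (Q : Query L V) : querySubst Q .var = Q := by
  simp only [querySubst, Atom.subst_var, List.map_id']

theorem querySubst_querySubst (Q : Query L V) (f g : V → L.Term V) :
    querySubst (querySubst Q f) g = querySubst Q fun x => (f x).subst g := by
  simp only [querySubst, List.map_map, Function.comp_def, Atom.subst_subst]

theorem mem_queryVars_querySubst {Q : Query L V} {f : V → L.Term V} {y : V} :
    y ∈ queryVars (querySubst Q f) ↔ ∃ x ∈ queryVars Q, y ∈ termVars (f x) := by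
  constructor
  · rintro ⟨B, hB, hy⟩
    obtain ⟨A, hA, rfl⟩ := List.mem_map.1 hB
    obtain ⟨x, hx, hy⟩ := Atom.mem_vars_subst.1 hy
    exact ⟨x, ⟨A, hA, hx⟩, hy⟩
  · rintro ⟨x, ⟨A, hA, hx⟩, hy⟩
    exact ⟨_, List.mem_map.2 ⟨A, hA, rfl⟩, Atom.mem_vars_subst.2 ⟨x, hx, hy⟩⟩

theorem Clause.subst_subst (C : Clause L V) (f g : V → L.Term V) :
    (C.subst f).subst g = C.subst fun x => (f x).subst g := by
  simp only [Clause.subst, Atom.subst_subst, querySubst_querySubst]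

/-- The node of an atom: the occurrences of variables in its output and in its input positions. -/
def Atom.node (M : Moding L) (A : Atom L V) : IONode V :=
  ⟨(outTerms M A).flatMap termOccs, (inTerms M A).flatMap termOccs⟩

/-- The nodes of a clause: those of the body, and two nodes for the head. From inside the clause,
the inputs of the head are data sources and its outputs are data sinks. -/
def Clause.nodes (M : Moding L) (C : Clause L V) : List (IONode V) :=
  ⟨(C.head.node M).inp, []⟩ :: ⟨[], (C.head.node M).out⟩ :: C.body.map (Atom.node M)

theorem mem_varOut {M : Moding L} {A : Atom L V} {x : V} :
    x ∈ varOut M A ↔ x ∈ (A.node M).out :=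
  List.mem_flatMap.symm

theorem mem_varIn {M : Moding L} {A : Atom L V} {x : V} :
    x ∈ varIn M A ↔ x ∈ (A.node M).inp :=
  List.mem_flatMap.symm

theorem Atom.mem_vars_iff (M : Moding L) {A : Atom L V} {x : V} :
    x ∈ A.vars ↔ x ∈ (A.node M).out ∨ x ∈ (A.node M).inp := by
  simp only [← mem_varOut, ← mem_varIn]
  constructor
  · rintro ⟨i, hi⟩
    cases hM : M A.arity A.pred i with
    | input => exact .inr ⟨A.args i, List.mem_map_of_mem (by simp [hM]), hi⟩
    | output => exact .inl ⟨A.args i, List.mem_map_of_mem (by simp [hM]), hi⟩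
  · rintro (⟨t, ht, hx⟩ | ⟨t, ht, hx⟩) <;>
    · obtain ⟨i, -, rfl⟩ := List.mem_map.1 ht
      exact ⟨i, hx⟩

theorem nodeVars_map_node (M : Moding L) (Q : Query L V) :
    nodeVars (Q.map (Atom.node M)) = queryVars Q := by
  ext x
  simp only [nodeVars, queryVars, Set.mem_ofPred_eq, List.mem_map, Atom.mem_vars_iff M]
  constructor
  · rintro ⟨_, ⟨A, hA, rfl⟩, hx⟩
    exact ⟨A, hA, hx⟩
  · rintro ⟨A, hA, hx⟩
    exact ⟨_, ⟨A, hA, rfl⟩, hx⟩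

theorem nodeVars_clause_nodes (M : Moding L) (C : Clause L V) :
    nodeVars (C.nodes M) = C.vars := by
  ext x
  rw [Clause.vars, ← nodeVars_map_node M, Set.mem_union, Atom.mem_vars_iff M]
  simp only [nodeVars, Clause.nodes, Set.mem_ofPred_eq, List.exists_mem_cons_iff, List.not_mem_nil,
    or_false, false_or]
  rw [or_left_comm, or_assoc]

theorem Atom.node_subst (M : Moding L) (A : Atom L V) (f : V → L.Term V) :
    (A.subst f).node M = (A.node M).bind fun x => termOccs (f x) := by
  simp only [Atom.node, IONode.bind, outTerms, inTerms, Atom.subst, List.flatMap_map,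
    List.flatMap_assoc, termOccs_subst]
  rfl

theorem map_node_querySubst (M : Moding L) (Q : Query L V) (f : V → L.Term V) :
    (querySubst Q f).map (Atom.node M) =
      (Q.map (Atom.node M)).map (IONode.bind fun x => termOccs (f x)) := by
  simp only [querySubst, List.map_map, Function.comp_def, Atom.node_subst]

theorem nodes_clause_subst (M : Moding L) (C : Clause L V) (f : V → L.Term V) :
    (C.subst f).nodes M = (C.nodes M).map (IONode.bind fun x => termOccs (f x)) := by
  simp only [Clause.nodes, Clause.subst, map_node_querySubst, Atom.node_subst, List.map_cons]
  rfl

theorem transGen_arrow_of_transGen_flow {M : Moding L} {Q : Query L V} {x y : V}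
    (h : Relation.TransGen (Flow (Q.map (Atom.node M))) x y) :
    ∃ A ∈ Q, ∃ B ∈ Q, x ∈ varIn M A ∧ y ∈ varOut M B ∧ Relation.ReflTransGen (arrow M Q) A B := by
  induction h with
  | single h =>
    obtain ⟨_, hn, hx, hy⟩ := h
    obtain ⟨A, hA, rfl⟩ := List.mem_map.1 hn
    exact ⟨A, hA, A, hA, mem_varIn.2 hx, mem_varOut.2 hy, .refl⟩
  | tail _ h ih =>
    obtain ⟨A, hA, B, hB, hx, hy, hAB⟩ := ih
    obtain ⟨_, hn, hy', hz⟩ := h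
    obtain ⟨C, hC, rfl⟩ := List.mem_map.1 hn
    exact ⟨A, hA, C, hC, hx, mem_varOut.2 hz, hAB.tail ⟨hB, hC, _, hy, mem_varIn.2 hy'⟩⟩

theorem transGen_flow_of_transGen_arrow {M : Moding L} {Q : Query L V} {A B : Atom L V}
    (h : Relation.TransGen (arrow M Q) A B) :
    ∃ x ∈ varOut M A, ∃ y ∈ varIn M B,
      Relation.ReflTransGen (Flow (Q.map (Atom.node M))) x y := by
  induction h with
  | single h =>
    obtain ⟨-, -, x, hxA, hxB⟩ := h
    exact ⟨x, hxA, x, hxB, .refl⟩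
  | tail _ h ih =>
    obtain ⟨x, hx, y, hy, hxy⟩ := ih
    obtain ⟨hB, -, z, hzB, hzC⟩ := h
    exact ⟨x, hx, z, hzC,
      hxy.tail ⟨_, List.mem_map_of_mem hB, mem_varIn.1 hy, mem_varOut.1 hzB⟩⟩

theorem tidyQuery_iff {M : Moding L} {Q : Query L V} :
    TidyQuery M Q ↔ TidyNodes (Q.map (Atom.node M)) := by
  have hout : LinearSeq (Q.flatMap (outTerms M)) ↔
      ((Q.map (Atom.node M)).flatMap IONode.out).Nodup := by
    simp only [LinearSeq, List.flatMap_assoc, List.flatMap_map, Atom.node]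
  constructor
  · rintro ⟨hlin, hacyc⟩
    refine ⟨hout.1 hlin, fun x hx => ?_⟩
    obtain ⟨A, hA, B, hB, hxA, hxB, hAB⟩ := transGen_arrow_of_transGen_flow hx
    exact hacyc B hB (.head' ⟨hB, hA, x, hxB, hxA⟩ hAB)
  · intro hQ
    refine ⟨hout.2 hQ.nodup, fun A hA hAA => ?_⟩
    obtain ⟨x, hx, y, hy, hxy⟩ := transGen_flow_of_transGen_arrow hAA
    exact hQ.acyclic x
      (.tail' hxy ⟨_, List.mem_map_of_mem hA, mem_varIn.1 hy, mem_varOut.1 hx⟩)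

theorem tidyClause_iff {M : Moding L} {C : Clause L V} :
    TidyClause M C ↔ TidyNodes (C.nodes M) := by
  have hout : (C.nodes M).flatMap IONode.out =
      (C.head.node M).inp ++ (C.body.map (Atom.node M)).flatMap IONode.out := rfl
  have hflow : Flow (C.nodes M) ≤ Flow (C.body.map (Atom.node M)) := by
    rintro x y ⟨n, hn, hx, hy⟩
    rcases List.mem_cons.1 hn with rfl | hn
    · exact absurd hx List.not_mem_nil
    rcases List.mem_cons.1 hn with rfl | hn
    · exact absurd hy List.not_mem_nil
    · exact ⟨n, hn, hx, hy⟩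
  constructor
  · rintro ⟨hbody, hlin, hdis⟩
    rw [tidyQuery_iff] at hbody
    refine hbody.of_flow_le (hout ▸ List.nodup_append'.2 ⟨hlin, hbody.nodup, ?_⟩) hflow
    intro x hx hx'
    obtain ⟨_, hn, hxn⟩ := List.mem_flatMap.1 hx'
    obtain ⟨B, hB, rfl⟩ := List.mem_map.1 hn
    exact hdis x (mem_varIn.2 hx) B hB (mem_varOut.2 hxn)
  · intro hC
    obtain ⟨hlin, -, hdis⟩ := List.nodup_append'.1 (hout ▸ hC.nodup)
    refine ⟨tidyQuery_iff.2 (hC.of_sublist ((List.sublist_cons_self _ _).cons _)), hlin,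
      fun x hx B hB hxB => hdis (mem_varIn.1 hx) ?_⟩
    exact List.mem_flatMap_of_mem (List.mem_map_of_mem hB) (mem_varOut.1 hxB)

theorem TidyQuery.rename {M : Moding L} {Q : Query L V} (hQ : TidyQuery M Q) {ρ : V → V}
    (hρ : Set.InjOn ρ (queryVars Q)) : TidyQuery M (querySubst Q fun x => .var (ρ x)) := by
  rw [tidyQuery_iff, map_node_querySubst]
  simp only [termOccs_var]
  exact (tidyQuery_iff.1 hQ).rename ((nodeVars_map_node M Q).symm ▸ hρ)

theorem TidyQuery.subst_of_leftInverse {M : Moding L} {Q : Query L V} (hQ : TidyQuery M Q)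
    {f g : V → L.Term V} (hfg : ∀ x ∈ queryVars Q, (f x).subst g = .var x) :
    TidyQuery M (querySubst Q f) := by
  have hvar (x : V) : ∃ y, x ∈ queryVars Q → f x = .var y := by
    by_cases hx : x ∈ queryVars Q
    · cases hf : f x with
      | var y => exact ⟨y, fun _ => rfl⟩
      | func k ts =>
        have := hfg x hx
        rw [hf] at this
        nomatch this
    · exact ⟨x, fun h => absurd h hx⟩
  choose ρ hρ using hvar
  rw [querySubst_congr hρ]
  refine hQ.rename fun x hx y hy hxy => ?_
  have h : f x = f y := by rw [hρ x hx, hρ y hy, hxy]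
  have h' : (.var x : L.Term V) = .var y := by rw [← hfg x hx, ← hfg y hy, h]
  exact FirstOrder.Language.Term.var.inj h'

theorem TidyClause.rename {M : Moding L} {C : Clause L V} (hC : TidyClause M C) {ρ : V → V}
    (hρ : Function.Injective ρ) : TidyClause M (C.subst fun x => .var (ρ x)) := by
  rw [tidyClause_iff, nodes_clause_subst]
  simp only [termOccs_var]
  exact (tidyClause_iff.1 hC).rename hρ.injOn

theorem TidyQuery.subst_of_isPartialGrounding {M : Moding L} {Q : Query L V}
    (hQ : TidyQuery M Q) {f : V → L.Term V} (hf : IsPartialGrounding f) :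
    TidyQuery M (querySubst Q f) := by
  rw [tidyQuery_iff, map_node_querySubst]
  exact (tidyQuery_iff.1 hQ).bind_of_sublist hf.termOccs_sublist

theorem TidyClause.subst_of_isPartialGrounding {M : Moding L} {C : Clause L V}
    (hC : TidyClause M C) {f : V → L.Term V} (hf : IsPartialGrounding f) :
    TidyClause M (C.subst f) := by
  rw [tidyClause_iff, nodes_clause_subst]
  exact (tidyClause_iff.1 hC).bind_of_sublist hf.termOccs_sublist

/-- A single clause is weakly tidy: it is tidy after grounding the variables in the `+` positions
(under the 3-moding `M`) of its head. -/
def WeaklyTidyClause (M : ThreeModing L) (M' : Moding L) (C : Clause L V) : Prop :=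
  ∃ θ : Subst L V, GroundsHeadInputs M C θ ∧ TidyClause M' (C.subst θ.map)

theorem mem_varIn3_subst {M : ThreeModing L} {A : Atom L V} {f : V → L.Term V} {y : V} :
    y ∈ varIn3 M (A.subst f) ↔ ∃ x ∈ varIn3 M A, y ∈ termVars (f x) := by
  have h : inTerms3 M (A.subst f) = (inTerms3 M A).map fun t => t.subst f := by
    simp only [inTerms3, List.map_map]
    rfl
  simp only [varIn3, h, List.mem_map, Set.mem_ofPred_eq]
  constructor
  · rintro ⟨_, ⟨t, ht, rfl⟩, hy⟩
    obtain ⟨x, hx, hy⟩ := mem_termVars_subst.1 hy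
    exact ⟨x, ⟨t, ht, hx⟩, hy⟩
  · rintro ⟨x, ⟨t, ht, hx⟩, hy⟩
    exact ⟨_, ⟨t, ht, rfl⟩, mem_termVars_subst.2 ⟨x, hx, hy⟩⟩

theorem WeaklyTidyClause.tidyClause_subst {M : ThreeModing L} {M' : Moding L} {C : Clause L V}
    (hC : WeaklyTidyClause M M' C) {σ : V → L.Term V} (hσ : IsPartialGrounding σ)
    (hσC : ∀ x ∈ varIn3 M C.head, IsGround (σ x)) : TidyClause M' (C.subst σ) := by
  obtain ⟨θ, ⟨hground, hfix⟩, htidy⟩ := hC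
  have hoccs : (fun x => termOccs ((θ.map x).subst σ)) = fun x => termOccs (σ x) := by
    funext x
    by_cases hx : x ∈ varIn3 M C.head
    · rw [isGround_iff.1 ((hground x hx).subst σ), isGround_iff.1 (hσC x hx)]
    · rw [hfix x hx, FirstOrder.Language.Term.subst]
  have h := htidy.subst_of_isPartialGrounding hσ
  rw [tidyClause_iff, Clause.subst_subst, nodes_clause_subst, hoccs] at h
  rwa [tidyClause_iff, nodes_clause_subst]

theorem WeaklyTidyClause.of_isVariant {M : ThreeModing L} {M' : Moding L} {C C' : Clause L V}
    (hC : WeaklyTidyClause M M' C) (h : IsVariant C' C) : WeaklyTidyClause M M' C' := by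
  obtain ⟨θ, ⟨hground, hfix⟩, htidy⟩ := hC
  obtain ⟨ρ, rfl⟩ := h
  have hmem {x : V} : x ∈ varIn3 M (C.subst fun x => .var (ρ x)).head ↔
      ρ.symm x ∈ varIn3 M C.head := by
    simp only [Clause.subst, mem_varIn3_subst, mem_termVars_var, ← ρ.symm_apply_eq,
      exists_eq_right']
  let θ' : Subst L V :=
    { map := fun x => (θ.map (ρ.symm x)).subst fun y => .var (ρ y)
      finite_dom := (θ.finite_dom.image ρ).subset fun x hx => ⟨ρ.symm x, fun h => hx <| by
        rw [h, FirstOrder.Language.Term.subst, ρ.apply_symm_apply], ρ.apply_symm_apply x⟩ }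
  refine ⟨θ', ⟨fun x hx => (hground _ (hmem.1 hx)).subst _, fun x hx => ?_⟩, ?_⟩
  · change (θ.map (ρ.symm x)).subst _ = _
    rw [hfix _ (mt hmem.2 hx), FirstOrder.Language.Term.subst, ρ.apply_symm_apply]
  · have h := htidy.rename ρ.injective
    rw [Clause.subst_subst] at h ⊢
    simpa only [FirstOrder.Language.Term.subst, θ', ρ.symm_apply_apply] using h

/-! ### Unification -/

theorem Equation.mem_vars_subst {e : Equation L V} {f : V → L.Term V} {y : V} :
    y ∈ (e.subst f).vars ↔ ∃ x ∈ e.vars, y ∈ termVars (f x) := by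
  cases e <;> simp only [Equation.subst, Equation.vars, Set.mem_union, mem_termVars_subst,
    Atom.mem_vars_subst, or_and_right, exists_or]

theorem Equation.ne_and_mem_of_mem_vars_subst_single {X y : V} {t : L.Term V} {e : Equation L V}
    (ht : X ∉ termVars t) (h : y ∈ (e.subst (single X t)).vars) :
    y ≠ X ∧ (y ∈ e.vars ∨ y ∈ termVars t) := by
  obtain ⟨x, hx, hy⟩ := Equation.mem_vars_subst.1 h
  obtain ⟨-, hy⟩ | ⟨hne, rfl⟩ := eq_or_mem_of_mem_termVars_single hy
  · exact ⟨fun h => ht (h ▸ hy), .inr hy⟩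
  · exact ⟨hne, .inl hx⟩

theorem Equation.subst_single_eq_self {X : V} {t : L.Term V} {e : Equation L V}
    (h : X ∉ e.vars) : e.subst (single X t) = e := by
  cases e with
  | term a b =>
    exact congrArg₂ Equation.term (OccurCheck.subst_single_eq_self fun ha => h (.inl ha))
      (OccurCheck.subst_single_eq_self fun hb => h (.inr hb))
  | atom A B =>
    have hatom (C : Atom L V) (hC : X ∉ C.vars) : C.subst (single X t) = C :=
      congrArg (Atom.mk C.arity C.pred) <|
        funext fun i => OccurCheck.subst_single_eq_self fun hi => hC ⟨i, hi⟩
    exact congrArg₂ Equation.atom (hatom A fun hA => h (.inl hA)) (hatom B fun hB => h (.inr hB))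

/-- `f` unifies both sides of an equation. -/
def Equation.Unifies (f : V → L.Term V) : Equation L V → Prop
  | .term s t => s.subst f = t.subst f
  | .atom A B => A.subst f = B.subst f

/-- `f` is a unifier of a set of equations. -/
def UnifiesAll (f : V → L.Term V) (U : Set (Equation L V)) : Prop := ∀ e ∈ U, e.Unifies f

/-- The variables of a set of equations. -/
def equationVars (U : Set (Equation L V)) : Set V := {x | ∃ e ∈ U, x ∈ e.vars}

theorem Equation.unifies_subst {e : Equation L V} {f g : V → L.Term V} :
    (e.subst f).Unifies g ↔ e.Unifies fun x => (f x).subst g := by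
  cases e <;> simp only [Equation.Unifies, Equation.subst, Atom.subst_subst, subst_subst]

theorem Equation.unifies_func_iff {n : ℕ} {f : L.Functions n} {s t : Fin n → L.Term V}
    {g : V → L.Term V} : (Equation.term (.func f s) (.func f t)).Unifies g ↔
      UnifiesAll g (Set.range fun i => .term (s i) (t i)) := by
  simp only [Equation.Unifies, FirstOrder.Language.Term.subst, UnifiesAll, Set.forall_mem_range,
    FirstOrder.Language.Term.func.injEq, heq_eq_eq, true_and, funext_iff]

theorem Equation.subst_var (e : Equation L V) : e.subst .var = e := by
  cases e <;> simp only [Equation.subst, OccurCheck.subst_var, Atom.subst_var]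

theorem Equation.subst_subst (e : Equation L V) (f g : V → L.Term V) :
    (e.subst f).subst g = e.subst fun x => (f x).subst g := by
  cases e <;> simp only [Equation.subst, OccurCheck.subst_subst, Atom.subst_subst]

theorem unifiesAll_image_subst {U : Set (Equation L V)} {f g : V → L.Term V} :
    UnifiesAll g (Equation.subst f '' U) ↔ UnifiesAll (fun x => (f x).subst g) U := by
  simp only [UnifiesAll, Set.forall_mem_image, Equation.unifies_subst]

theorem single_subst_eq_of_unifies {X : V} {t : L.Term V} {f : V → L.Term V}
    (h : (Equation.term (.var X) t).Unifies f) : (fun x => (single X t x).subst f) = f := by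
  funext x
  obtain rfl | hne := eq_or_ne x X
  · rw [single_same]
    exact h.symm
  · rw [single_of_ne t hne, FirstOrder.Language.Term.subst]

theorem unifies_single_subst {X : V} {t : L.Term V} (hX : X ∉ termVars t) (f : V → L.Term V) :
    (Equation.term (.var X) t).Unifies fun x => (single X t x).subst f := by
  rw [← Equation.unifies_subst, Equation.subst, subst_single_eq_self hX,
    FirstOrder.Language.Term.subst, single_same]
  rfl

theorem unifiesAll_sdiff_singleton_union {U N : Set (Equation L V)} {e : Equation L V}
    {f : V → L.Term V} (he : e ∈ U) (hN : e.Unifies f ↔ UnifiesAll f N) :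
    UnifiesAll f (U \ {e} ∪ N) ↔ UnifiesAll f U := by
  refine ⟨fun h e' he' => ?_, fun h e' he' => ?_⟩
  · by_cases hee : e' = e
    · exact hee ▸ hN.2 fun e hN => h e (.inr hN)
    · exact h e' (.inl ⟨he', hee⟩)
  · exact he'.elim (fun he' => h e' he'.1) (hN.1 (h e he) e')

/-- The composition `θη` of substitutions: first `θ`, then `η`. -/
def Subst.comp (θ η : Subst L V) : Subst L V where
  map x := (θ.map x).subst η.map
  finite_dom := (θ.finite_dom.union η.finite_dom).subset fun x hx => by
    by_contra h
    simp only [Set.mem_union, Set.mem_ofPred_eq, not_or, not_not] at h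
    exact hx (by rw [h.1, FirstOrder.Language.Term.subst, h.2])

/-- The substitution `{X/t}`. -/
noncomputable def Subst.single (X : V) (t : L.Term V) : Subst L V where
  map := OccurCheck.single X t
  finite_dom := (Set.finite_singleton X).subset fun _ hx => by_contra fun h => hx (single_of_ne t h)

/-- `μ` is an idempotent most general unifier of a set of equations: each unifier `f` factors
through `μ` as `f = μf`. -/
structure IsIdempotentMGU (μ : Subst L V) (U : Set (Equation L V)) : Prop where
  unifies : UnifiesAll μ.map U
  factors : ∀ f, UnifiesAll f U → ∀ x, (μ.map x).subst f = f x

theorem IsIdempotentMGU.eliminate {μ : Subst L V} {U : Set (Equation L V)} {X : V} {t : L.Term V}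
    (hX : X ∉ termVars t) (he : .term (.var X) t ∈ U)
    (hμ : IsIdempotentMGU μ (Equation.subst (single X t) '' (U \ {.term (.var X) t}))) :
    IsIdempotentMGU ((Subst.single X t).comp μ) U where
  unifies e heU := by
    by_cases hee : e = .term (.var X) t
    · exact hee ▸ unifies_single_subst hX μ.map
    · exact unifiesAll_image_subst.1 hμ.unifies e ⟨heU, hee⟩
  factors f hf x := by
    have hsingle := single_subst_eq_of_unifies (hf _ he)
    have hf' : UnifiesAll f (Equation.subst (single X t) '' (U \ {.term (.var X) t})) := by
      rw [unifiesAll_image_subst, hsingle]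
      exact fun e he' => hf e he'.1
    change ((single X t x).subst μ.map).subst f = f x
    simp only [subst_subst, hμ.factors f hf']
    exact congrFun hsingle x

/-! ### Runs of the Martelli-Montanari algorithm -/

/-- Each equation of `S` binds a variable that occurs neither elsewhere in `S` nor in `W`. -/
def Solved (S : Set (Equation L V)) (W : Set V) : Prop :=
  ∀ e ∈ S, ∃ (X : V) (t : L.Term V), e = .term (.var X) t ∧ X ∉ termVars t ∧ X ∉ W ∧
    ∀ e' ∈ S, e' ≠ e → X ∉ e'.vars

theorem Solved.mono {S : Set (Equation L V)} {W W' : Set V} (hS : Solved S W) (hW : W' ⊆ W) :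
    Solved S W' := fun e he =>
  let ⟨X, t, het, hXt, hXW, hXS⟩ := hS e he
  ⟨X, t, het, hXt, fun h => hXW (hW h), hXS⟩

theorem Solved.notMem {S U : Set (Equation L V)} (hS : Solved S (equationVars U))
    {e : Equation L V} (he : e ∈ U) : e ∉ S := fun heS =>
  let ⟨_, _, het, _, hXU, _⟩ := hS e heS
  hXU ⟨e, he, het ▸ .inl (mem_termVars_var.2 rfl)⟩

theorem Solved.union_sdiff_singleton {S U : Set (Equation L V)} (hS : Solved S (equationVars U))
    {e : Equation L V} (he : e ∈ U) : (S ∪ U) \ {e} = S ∪ U \ {e} := by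
  rw [Set.union_sdiff_distrib, Set.sdiff_singleton_eq_self (hS.notMem he)]

theorem Solved.eq_of_mem {S : Set (Equation L V)} {W : Set V} (hS : Solved S W) {s t : L.Term V}
    (he : .term s t ∈ S) : ∃ X, s = .var X ∧ X ∉ termVars t ∧
      ∀ e ∈ S, e ≠ .term s t → X ∉ e.vars := by
  obtain ⟨X, t, het, hXt, -, hXS⟩ := hS _ he
  obtain ⟨rfl, rfl⟩ := Equation.term.inj het
  exact ⟨X, rfl, hXt, hXS⟩

theorem Solved.atom_notMem {S : Set (Equation L V)} {W : Set V} (hS : Solved S W)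
    (A B : Atom L V) : .atom A B ∉ S := fun h =>
  let ⟨_, _, het, _⟩ := hS _ h
  nomatch het

theorem Solved.func_notMem {S : Set (Equation L V)} {W : Set V} (hS : Solved S W) {n : ℕ}
    (f : L.Functions n) (s : Fin n → L.Term V) (t : L.Term V) : .term (.func f s) t ∉ S := fun h =>
  let ⟨_, hs, _⟩ := hS.eq_of_mem h
  nomatch hs

theorem Solved.final {S : Set (Equation L V)} {W : Set V} (hS : Solved S W) : Final S := by
  refine ⟨fun E' hE' => ?_, ?_, ?_⟩
  · cases hE' with
    | decomposeTerm n f s t he => exact hS.func_notMem f s _ he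
    | decomposeAtom n p s t he => exact hS.atom_notMem _ _ he
    | delete X he =>
      obtain ⟨Y, hXY, hY, -⟩ := hS.eq_of_mem he
      exact hY (hXY ▸ mem_termVars_var.2 rfl)
    | orient t X he ht =>
      obtain ⟨Y, htY, -⟩ := hS.eq_of_mem he
      exact ht ⟨Y, htY⟩
    | eliminate X t he _ hX =>
      obtain ⟨_, ⟨⟩, -, hXS⟩ := hS.eq_of_mem he
      obtain ⟨e, ⟨heS, hne⟩, hXe⟩ := hX
      exact hXS e heS hne hXe
  · rintro (⟨m, n, f, g, s, t, -, he⟩ | ⟨A, B, -, he⟩)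
    · exact hS.func_notMem f s _ he
    · exact hS.atom_notMem A B he
  · rintro ⟨X, t, hX, -, he⟩
    obtain ⟨_, ⟨⟩, hXt, -⟩ := hS.eq_of_mem he
    exact hXt hX

theorem Solved.eliminate {S U : Set (Equation L V)} (hS : Solved S (equationVars U)) {X : V}
    {t : L.Term V} (hX : X ∉ termVars t) (he : .term (.var X) t ∈ U) :
    Solved (Equation.subst (single X t) '' S ∪ {.term (.var X) t})
      (equationVars (Equation.subst (single X t) '' (U \ {.term (.var X) t}))) := by
  have hX' (e : Equation L V) : X ∉ (e.subst (single X t)).vars := fun h =>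
    (Equation.ne_and_mem_of_mem_vars_subst_single hX h).1 rfl
  rintro e (⟨e, heS, rfl⟩ | rfl)
  · obtain ⟨Y, r, rfl, hYr, hYU, hYS⟩ := hS e heS
    have hYt : Y ∉ termVars t := fun h => hYU ⟨_, he, .inr h⟩
    have hYX : Y ≠ X := fun h => hYU ⟨_, he, .inl (mem_termVars_var.2 h)⟩
    have hnotMem (e' : Equation L V) (he' : Y ∉ e'.vars) : Y ∉ (e'.subst (single X t)).vars :=
      fun h => (Equation.ne_and_mem_of_mem_vars_subst_single hX h).2.elim he' hYt
    refine ⟨Y, r.subst (single X t), congrArg₂ Equation.term (single_of_ne t hYX) rfl, ?_, ?_, ?_⟩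
    · intro h
      obtain ⟨x, hx, hy⟩ := mem_termVars_subst.1 h
      obtain ⟨-, hy⟩ | ⟨-, rfl⟩ := eq_or_mem_of_mem_termVars_single hy
      · exact hYt hy
      · exact hYr hx
    · rintro ⟨_, ⟨e', he', rfl⟩, hY⟩
      exact hnotMem e' (fun h => hYU ⟨e', he'.1, h⟩) hY
    · rintro _ (⟨e', he', rfl⟩ | rfl) hne
      · exact hnotMem e' (hYS e' he' fun h => hne (congrArg _ h))
      · exact fun h => hYU ⟨_, he, h⟩
  · refine ⟨X, t, rfl, hX, ?_, ?_⟩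
    · rintro ⟨_, ⟨e, -, rfl⟩, h⟩
      exact hX' e h
    · rintro _ (⟨e, -, rfl⟩ | rfl) hne
      · exact hX' e
      · exact absurd rfl hne

theorem Clash.mono {E E' : Set (Equation L V)} (h : Clash E) (hE : E ⊆ E') : Clash E' :=
  h.imp (fun ⟨m, n, f, g, s, t, hne, he⟩ => ⟨m, n, f, g, s, t, hne, hE he⟩)
    fun ⟨A, B, hne, he⟩ => ⟨A, B, hne, hE he⟩

theorem Atom.symbol_eq_of_subst_eq {A B : Atom L V} {f g : V → L.Term V}
    (h : A.subst f = B.subst g) : A.symbol = B.symbol :=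
  show (A.subst f).symbol = (B.subst g).symbol from congrArg Atom.symbol h

theorem Clash.not_unifiesAll {E : Set (Equation L V)} (h : Clash E) (f : V → L.Term V) :
    ¬ UnifiesAll f E := by
  intro hf
  obtain ⟨m, n, g, k, s, t, hne, he⟩ | ⟨A, B, hne, he⟩ := h
  · obtain ⟨rfl, hgk, -⟩ := FirstOrder.Language.Term.func.inj (hf _ he)
    exact hne (congrArg _ (eq_of_heq hgk))
  · exact hne (Atom.symbol_eq_of_subst_eq (hf _ he))

theorem WNSTO.of_step {E E' : Set (Equation L V)} (h : MMAStep E E') (hE : WNSTO E') : WNSTO E :=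
  let ⟨E'', hrun, hhalt⟩ := hE
  ⟨E'', .head h hrun, hhalt⟩

theorem WNSTO.of_eliminate {E : Set (Equation L V)} {X : V} {t : L.Term V}
    (hX : X ∉ termVars t) (he : .term (.var X) t ∈ E)
    (h : WNSTO (Equation.subst (single X t) '' (E \ {.term (.var X) t}) ∪ {.term (.var X) t})) :
    WNSTO E := by
  by_cases hocc : ∃ e ∈ E \ {.term (.var X) t}, X ∈ e.vars
  · exact .of_step (.eliminate E X t he hX hocc) h
  · push Not at hocc
    have himage : Equation.subst (single X t) '' (E \ {.term (.var X) t}) =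
        E \ {.term (.var X) t} :=
      (Set.image_congr fun e he' => Equation.subst_single_eq_self (hocc e he')).trans
        (Set.image_id' _)
    rwa [himage, Set.sdiff_union_of_subset (Set.singleton_subset_iff.2 he)] at h

/-- The equations `U` can be unified without occur-check failure, also in the presence of equations
that are already solved, and the unification of `U`, if it succeeds, makes the query `K` tidy. -/
structure UnifiesTidily (M : Moding L) (U : Set (Equation L V)) (K : Query L V) : Prop where
  wnsto : ∀ S, Solved S (equationVars U) → WNSTO (S ∪ U)
  tidy : (∃ f, UnifiesAll f U) → ∃ μ : Subst L V, IsIdempotentMGU μ U ∧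
    TidyQuery M (querySubst K μ.map)

namespace UnifiesTidily

variable {M : Moding L} {U : Set (Equation L V)} {K : Query L V}

theorem wnsto_self (h : UnifiesTidily M U K) : WNSTO U := by
  have hempty := h.wnsto ∅ fun e he => absurd he (Set.notMem_empty e)
  rwa [Set.empty_union] at hempty

theorem tidyQuery_of_isMGU {A B : Atom L V} {θ : Subst L V}
    (h : UnifiesTidily M {.atom A B} K) (hθ : IsMGU θ A B) :
    TidyQuery M (querySubst K θ.map) := by
  have hunifies : UnifiesAll θ.map {.atom A B} := by
    rintro _ rfl
    exact hθ.1
  obtain ⟨μ, hμ, htidy⟩ := h.tidy ⟨θ.map, hunifies⟩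
  obtain ⟨η, hη⟩ := hθ.2 μ (hμ.unifies _ rfl)
  have hK : querySubst K θ.map = querySubst (querySubst K μ.map) θ.map := by
    simp only [querySubst_querySubst, hμ.factors θ.map hunifies]
  rw [hK]
  refine htidy.subst_of_leftInverse (g := η.map) fun x hx => ?_
  obtain ⟨y, -, hxy⟩ := mem_queryVars_querySubst.1 hx
  rw [hη x]
  exact subst_eq_self_iff.1 (hμ.factors μ.map hμ.unifies y) x hxy

theorem of_empty (hK : TidyQuery M K) : UnifiesTidily M ∅ K where
  wnsto S hS := by
    rw [Set.union_empty]
    exact ⟨S, .refl, .inr hS.final⟩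
  tidy _ := by
    refine ⟨⟨.var, ?_⟩, ⟨fun e he => absurd he (Set.notMem_empty e), fun f _ x => rfl⟩, ?_⟩
    · simp only [ne_eq, not_true_eq_false, Set.ofPred_false, Set.finite_empty]
    · rwa [querySubst_var]

theorem of_not_unifiable (hwnsto : ∀ S, WNSTO (S ∪ U)) (hU : ¬ ∃ f, UnifiesAll f U) :
    UnifiesTidily M U K where
  wnsto S _ := hwnsto S
  tidy h := absurd h hU

theorem of_replace {e : Equation L V} {N : Set (Equation L V)} (he : e ∈ U)
    (hstep : ∀ E, e ∈ E → MMAStep E (E \ {e} ∪ N)) (hvars : equationVars N ⊆ e.vars)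
    (hunifies : ∀ f, e.Unifies f ↔ UnifiesAll f N) (h : UnifiesTidily M (U \ {e} ∪ N) K) :
    UnifiesTidily M U K where
  wnsto S hS := by
    refine .of_step (hstep _ (.inr he)) ?_
    rw [hS.union_sdiff_singleton he, Set.union_assoc]
    refine h.wnsto S (hS.mono ?_)
    rintro x ⟨e', he' | he', hx⟩
    · exact ⟨e', he'.1, hx⟩
    · exact ⟨e, he, hvars ⟨e', he', hx⟩⟩
  tidy := by
    rintro ⟨f, hf⟩
    obtain ⟨μ, hμ, htidy⟩ := h.tidy ⟨f, (unifiesAll_sdiff_singleton_union he (hunifies f)).2 hf⟩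
    exact ⟨μ, ⟨(unifiesAll_sdiff_singleton_union he (hunifies _)).1 hμ.unifies, fun f hf =>
      hμ.factors f ((unifiesAll_sdiff_singleton_union he (hunifies f)).2 hf)⟩, htidy⟩

theorem of_decomposeAtom {n : ℕ} {p : L.Relations n} {s t : Fin n → L.Term V}
    (h : UnifiesTidily M (Set.range fun i => .term (s i) (t i)) K) :
    UnifiesTidily M {.atom ⟨n, p, s⟩ ⟨n, p, t⟩} K := by
  refine of_replace rfl (fun E he => .decomposeAtom E n p s t he) ?_ (fun f => ?_) ?_
  · rintro x ⟨_, ⟨i, rfl⟩, hx⟩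
    exact hx.imp (fun h => ⟨i, h⟩) fun h => ⟨i, h⟩
  · simp only [Equation.Unifies, Atom.subst, UnifiesAll, Set.forall_mem_range, Atom.mk.injEq,
      heq_eq_eq, true_and, funext_iff]
  · rwa [Set.sdiff_self, Set.empty_union]

theorem of_decomposeTerm {n : ℕ} {f : L.Functions n} {s t : Fin n → L.Term V}
    (he : .term (.func f s) (.func f t) ∈ U)
    (h : UnifiesTidily M
      (U \ {.term (.func f s) (.func f t)} ∪ Set.range fun i => .term (s i) (t i)) K) :
    UnifiesTidily M U K := by
  refine of_replace he (fun E he => .decomposeTerm E n f s t he) ?_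
    (fun _ => Equation.unifies_func_iff) h
  rintro x ⟨_, ⟨i, rfl⟩, hx⟩
  exact hx.imp (fun h => mem_termVars_func.2 ⟨i, h⟩) fun h => mem_termVars_func.2 ⟨i, h⟩

theorem of_orient {X : V} {t : L.Term V} (ht : ¬ IsVar t) (he : .term t (.var X) ∈ U)
    (h : UnifiesTidily M (U \ {.term t (.var X)} ∪ {.term (.var X) t}) K) :
    UnifiesTidily M U K := by
  refine of_replace he (fun E he => .orient E t X he ht) ?_ (fun f => ?_) h
  · rintro x ⟨_, rfl, hx⟩
    exact hx.symm
  · simp only [UnifiesAll, Set.mem_singleton_iff, forall_eq, Equation.Unifies]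
    exact eq_comm

theorem of_clash (h : Clash U) : UnifiesTidily M U K :=
  of_not_unifiable (fun _ => ⟨_, .refl, .inl (h.mono Set.subset_union_right)⟩)
    fun ⟨f, hf⟩ => h.not_unifiesAll f hf

theorem of_eliminate {X : V} {t : L.Term V} (hX : X ∉ termVars t) (he : .term (.var X) t ∈ U)
    (h : UnifiesTidily M (Equation.subst (single X t) '' (U \ {.term (.var X) t}))
      (querySubst K (single X t))) :
    UnifiesTidily M U K where
  wnsto S hS := by
    have hrun := h.wnsto _ (hS.eliminate hX he)
    rw [Set.union_right_comm, ← Set.image_union, ← hS.union_sdiff_singleton he] at hrun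
    exact .of_eliminate hX (.inr he) hrun
  tidy := by
    rintro ⟨f, hf⟩
    obtain ⟨μ, hμ, htidy⟩ := h.tidy ⟨f, by
      rw [unifiesAll_image_subst, single_subst_eq_of_unifies (hf _ he)]
      exact fun e he' => hf e he'.1⟩
    exact ⟨_, hμ.eliminate hX he, by rwa [querySubst_querySubst] at htidy⟩

end UnifiesTidily

/-- The equation `e` binds `X` to `t`, possibly after a reorientation. -/
def Binds (e : Equation L V) (X : V) (t : L.Term V) : Prop :=
  e = .term (.var X) t ∨ (e = .term t (.var X) ∧ ¬ IsVar t)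

theorem Binds.vars_eq {e : Equation L V} {X : V} {t : L.Term V} (h : Binds e X t) :
    e.vars = insert X (termVars t) := by
  have hX : termVars (.var X : L.Term V) = {X} := Set.ext fun x => mem_termVars_var
  obtain rfl | ⟨rfl, -⟩ := h
  · rw [Equation.vars, hX, Set.singleton_union]
  · rw [Equation.vars, hX, Set.union_singleton]

theorem Binds.unifies_iff {e : Equation L V} {X : V} {t : L.Term V} (h : Binds e X t)
    {f : V → L.Term V} : e.Unifies f ↔ (Equation.term (.var X) t).Unifies f := by
  obtain rfl | ⟨rfl, -⟩ := h
  · rfl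
  · exact eq_comm

theorem UnifiesTidily.of_binds {M : Moding L} {U : Set (Equation L V)} {K : Query L V}
    {e : Equation L V} {X : V} {t : L.Term V} (he : e ∈ U) (het : Binds e X t)
    (hX : X ∉ termVars t)
    (h : UnifiesTidily M (Equation.subst (single X t) '' (U \ {e, .term (.var X) t}))
      (querySubst K (single X t))) :
    UnifiesTidily M U K := by
  obtain rfl | ⟨rfl, ht⟩ := het
  · rw [Set.pair_eq_singleton] at h
    exact of_eliminate hX he h
  · refine of_orient ht he (of_eliminate hX (.inr rfl) ?_)
    rwa [Set.union_sdiff_right, Set.sdiff_sdiff, Set.singleton_union]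

/-! ### Oriented equations -/

variable (L V) in
/-- An equation between terms one of whose sides is regarded as output and the other one as input.
The output is the left-hand side of the equation, unless the equation is `flipped`. -/
structure OrientedEq where
  out : L.Term V
  inp : L.Term V
  flipped : Bool

namespace OrientedEq

/-- The equation between terms that is being oriented. -/
def eqn : OrientedEq L V → Equation L V
  | ⟨s, t, false⟩ => .term s t
  | ⟨s, t, true⟩ => .term t s

/-- The node of an oriented equation: the occurrences of variables in its two sides. -/
def node (u : OrientedEq L V) : IONode V := ⟨termOccs u.out, termOccs u.inp⟩

/-- Application of a map from variables to terms to both sides. -/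
def subst (f : V → L.Term V) (u : OrientedEq L V) : OrientedEq L V :=
  ⟨u.out.subst f, u.inp.subst f, u.flipped⟩

theorem eqn_subst (f : V → L.Term V) (u : OrientedEq L V) :
    (u.subst f).eqn = u.eqn.subst f := by
  obtain ⟨s, t, _ | _⟩ := u <;> rfl

theorem node_subst (f : V → L.Term V) (u : OrientedEq L V) :
    (u.subst f).node = u.node.bind fun x => termOccs (f x) := by
  simp only [node, subst, IONode.bind, termOccs_subst]

theorem mem_vars_eqn {u : OrientedEq L V} {x : V} :
    x ∈ u.eqn.vars ↔ x ∈ termVars u.out ∨ x ∈ termVars u.inp := by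
  obtain ⟨s, t, _ | _⟩ := u
  · rfl
  · exact or_comm

theorem binds_or_decomposes_or_clash (u : OrientedEq L V) :
    (∃ X, u.out = .var X ∧ Binds u.eqn X u.inp) ∨ (∃ X, u.inp = .var X ∧ Binds u.eqn X u.out) ∨
      (∃ (n : ℕ) (f : L.Functions n) (s t : Fin n → L.Term V) (b : Bool),
        u = ⟨.func f s, .func f t, b⟩) ∨ Clash {u.eqn} := by
  have hfunc {n : ℕ} (f : L.Functions n) (s : Fin n → L.Term V) :
      ¬ IsVar (.func f s) := fun ⟨_, h⟩ => nomatch h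
  match u with
  | ⟨.var X, t, false⟩ => exact .inl ⟨X, rfl, .inl rfl⟩
  | ⟨.var X, .func f t, true⟩ => exact .inl ⟨X, rfl, .inr ⟨rfl, hfunc f t⟩⟩
  | ⟨s, .var X, true⟩ => exact .inr (.inl ⟨X, rfl, .inl rfl⟩)
  | ⟨.func f s, .var X, false⟩ => exact .inr (.inl ⟨X, rfl, .inr ⟨rfl, hfunc f s⟩⟩)
  | ⟨.func (l := m) f s, .func (l := n) g t, b⟩ =>
    by_cases hfg : (⟨m, f⟩ : Σ k, L.Functions k) = ⟨n, g⟩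
    · cases hfg
      exact .inr (.inr (.inl ⟨m, f, s, t, b, rfl⟩))
    · refine .inr (.inr (.inr (.inl ?_)))
      cases b with
      | false => exact ⟨m, n, f, g, s, t, hfg, rfl⟩
      | true => exact ⟨n, m, g, f, t, s, Ne.symm hfg, rfl⟩

end OrientedEq

/-- The set of equations underlying a list of oriented equations. -/
def equations (U : List (OrientedEq L V)) : Set (Equation L V) := {e | ∃ u ∈ U, u.eqn = e}

theorem equations_append (U U' : List (OrientedEq L V)) :
    equations (U ++ U') = equations U ∪ equations U' := by
  ext e
  simp only [equations, List.mem_append, or_and_right, exists_or, Set.mem_ofPred_eq, Set.mem_union]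

theorem image_subst_equations (f : V → L.Term V) (U : List (OrientedEq L V)) :
    Equation.subst f '' equations U = equations (U.map (OrientedEq.subst f)) := by
  ext e
  simp only [equations, Set.mem_image, Set.mem_ofPred_eq, List.mem_map, exists_exists_and_eq_and,
    OrientedEq.eqn_subst]

theorem sdiff_subset_equations {u : OrientedEq L V} {U : List (OrientedEq L V)}
    {E R : Set (Equation L V)} (hE : E ⊆ equations (u :: U)) (hu : u.eqn ∈ R) :
    E \ R ⊆ equations U := by
  rintro e ⟨heE, heR⟩
  obtain ⟨w, hw, rfl⟩ := hE heE
  obtain rfl | hw := List.mem_cons.1 hw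
  · exact absurd hu heR
  · exact ⟨w, hw, rfl⟩

theorem subset_equations_of_notMem {u : OrientedEq L V} {U : List (OrientedEq L V)}
    {E : Set (Equation L V)} (hE : E ⊆ equations (u :: U)) (hu : u.eqn ∉ E) : E ⊆ equations U := by
  rw [← Set.sdiff_singleton_eq_self hu]
  exact sdiff_subset_equations hE rfl

theorem equations_nil : equations ([] : List (OrientedEq L V)) = ∅ := by
  simp only [equations, List.not_mem_nil, false_and, exists_false, Set.ofPred_false]

/-- The equations `s i ≐ t i`, oriented alike. -/
def argEqs {n : ℕ} (s t : Fin n → L.Term V) (b : Bool) : List (OrientedEq L V) :=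
  (List.finRange n).map fun i => ⟨s i, t i, b⟩

theorem equations_argEqs {n : ℕ} (s t : Fin n → L.Term V) (b : Bool) :
    equations (argEqs s t b) = Set.range fun i => OrientedEq.eqn ⟨s i, t i, b⟩ := by
  ext e
  simp only [equations, argEqs, List.mem_map, List.mem_finRange, true_and, Set.mem_ofPred_eq,
    exists_exists_eq_and, Set.mem_range]

theorem UnifiesTidily.of_oriented_decompose {M : Moding L} {K : Query L V} {n : ℕ}
    {f : L.Functions n} {s t : Fin n → L.Term V} {b : Bool} {E : Set (Equation L V)}
    (he : OrientedEq.eqn ⟨.func f s, .func f t, b⟩ ∈ E)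
    (h : UnifiesTidily M
      (equations (argEqs s t b) ∪ E \ {OrientedEq.eqn ⟨.func f s, .func f t, b⟩}) K) :
    UnifiesTidily M E K := by
  rw [Set.union_comm, equations_argEqs] at h
  cases b <;> exact .of_decomposeTerm he h

/-- The number of symbols of a term. -/
def termSize : L.Term V → ℕ
  | .var _ => 1
  | .func _ ts => (List.ofFn fun i => termSize (ts i)).sum + 1

theorem termSize_pos (t : L.Term V) : 0 < termSize t := by
  cases t <;> exact Nat.succ_pos _

namespace OrientedEq

open Classical in
/-- The variables of a list of oriented equations. -/
noncomputable def vars (U : List (OrientedEq L V)) : Finset V :=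
  (U.flatMap fun u => termOccs u.out ++ termOccs u.inp).toFinset

/-- The termination measure of unification: the number of variables, which decreases when a variable
is eliminated, and then the number of symbols in the outputs, which decreases on decomposition. -/
noncomputable def complexity (U : List (OrientedEq L V)) : ℕ ×ₗ ℕ :=
  toLex ((vars U).card, (U.map fun u => termSize u.out).sum)

theorem mem_vars {U : List (OrientedEq L V)} {x : V} : x ∈ vars U ↔ ∃ u ∈ U, x ∈ u.eqn.vars := by
  simp only [vars, List.mem_toFinset, List.mem_flatMap, List.mem_append, mem_vars_eqn, mem_termVars]

theorem complexity_lt_of_vars_ssubset {U W : List (OrientedEq L V)} (h : vars U ⊂ vars W) :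
    complexity U < complexity W :=
  Prod.Lex.toLex_lt_toLex.2 (.inl (Finset.card_lt_card h))

theorem complexity_lt_of_vars_subset {U W : List (OrientedEq L V)} (h : vars U ⊆ vars W)
    (hsize : (U.map fun u => termSize u.out).sum < (W.map fun u => termSize u.out).sum) :
    complexity U < complexity W :=
  Prod.Lex.toLex_lt_toLex'.2 ⟨Finset.card_le_card h, fun _ => hsize⟩

theorem complexity_lt_cons (u : OrientedEq L V) (U : List (OrientedEq L V)) :
    complexity U < complexity (u :: U) := by
  refine complexity_lt_of_vars_subset (fun x hx => ?_) (Nat.lt_add_of_pos_left (termSize_pos u.out))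
  obtain ⟨w, hw, hx⟩ := mem_vars.1 hx
  exact mem_vars.2 ⟨w, List.mem_cons_of_mem _ hw, hx⟩

theorem complexity_argEqs_append_lt {n : ℕ} {f : L.Functions n} {s t : Fin n → L.Term V} {b : Bool}
    {U : List (OrientedEq L V)} :
    complexity (argEqs s t b ++ U) < complexity (⟨.func f s, .func f t, b⟩ :: U) := by
  refine complexity_lt_of_vars_subset (fun x hx => ?_) ?_
  · obtain ⟨w, hw, hx⟩ := mem_vars.1 hx
    obtain hw | hw := List.mem_append.1 hw
    · obtain ⟨i, -, rfl⟩ := List.mem_map.1 hw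
      exact mem_vars.2 ⟨_, List.mem_cons_self, mem_vars_eqn.2 <| (mem_vars_eqn.1 hx).imp
        (fun h => mem_termVars_func.2 ⟨i, h⟩) fun h => mem_termVars_func.2 ⟨i, h⟩⟩
    · exact mem_vars.2 ⟨w, List.mem_cons_of_mem _ hw, hx⟩
  · have hargs : ((argEqs s t b).map fun u => termSize u.out).sum + 1 =
        termSize (.func f s : L.Term V) := by
      rw [argEqs, List.map_map, termSize, List.ofFn_eq_map]
      rfl
    simp only [List.map_append, List.sum_append, List.map_cons, List.sum_cons]
    lia

theorem complexity_map_subst_single_lt {u : OrientedEq L V} {U : List (OrientedEq L V)} {X : V}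
    {t : L.Term V} (hu : Binds u.eqn X t) (hX : X ∉ termVars t) :
    complexity (U.map (.subst (single X t))) < complexity (u :: U) := by
  have hsubst {x : V} (hx : x ∈ vars (U.map (.subst (single X t)))) :
      x ≠ X ∧ x ∈ vars (u :: U) := by
    obtain ⟨_, hmem, hx⟩ := mem_vars.1 hx
    obtain ⟨w, hw, rfl⟩ := List.mem_map.1 hmem
    rw [eqn_subst] at hx
    obtain ⟨hne, hx⟩ := Equation.ne_and_mem_of_mem_vars_subst_single hX hx
    refine ⟨hne, mem_vars.2 ?_⟩
    obtain hx | hx := hx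
    · exact ⟨w, List.mem_cons_of_mem _ hw, hx⟩
    · exact ⟨u, List.mem_cons_self, hu.vars_eq ▸ .inr hx⟩
  exact complexity_lt_of_vars_ssubset <|
    (Finset.ssubset_iff_of_subset fun x hx => (hsubst hx).2).2
      ⟨X, mem_vars.2 ⟨u, List.mem_cons_self, hu.vars_eq ▸ .inl rfl⟩, fun hx => (hsubst hx).1 rfl⟩

theorem unification_induction {motive : List (OrientedEq L V) → Prop} (nil : motive [])
    (cons : ∀ u U, motive U →
      (∀ X t, Binds u.eqn X t → X ∉ termVars t → motive (U.map (.subst (single X t)))) →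
      (∀ (n : ℕ) (f : L.Functions n) (s t : Fin n → L.Term V) (b : Bool),
        u = ⟨.func f s, .func f t, b⟩ → motive (argEqs s t b ++ U)) → motive (u :: U))
    (U : List (OrientedEq L V)) : motive U := by
  refine (InvImage.wf complexity wellFounded_lt).induction U fun U ih => ?_
  cases U with
  | nil => exact nil
  | cons u U =>
    refine cons u U (ih _ (complexity_lt_cons u U))
      (fun X t hu hX => ih _ (complexity_map_subst_single_lt hu hX)) ?_
    rintro n f s t b rfl
    exact ih _ complexity_argEqs_append_lt

end OrientedEq

theorem map_node_append_map_subst (M : Moding L) (U : List (OrientedEq L V)) (K : Query L V)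
    (f : V → L.Term V) :
    (U.map (.subst f)).map OrientedEq.node ++ (querySubst K f).map (Atom.node M) =
      (U.map OrientedEq.node ++ K.map (Atom.node M)).map (IONode.bind fun x => termOccs (f x)) := by
  simp only [List.map_append, map_node_querySubst, List.map_map, Function.comp_def,
    OrientedEq.node_subst]

theorem UnifiesTidily.of_tidyNodes {M : Moding L} {U : List (OrientedEq L V)} {K : Query L V}
    {E : Set (Equation L V)} (hE : E ⊆ equations U)
    (hU : TidyNodes (U.map OrientedEq.node ++ K.map (Atom.node M))) : UnifiesTidily M E K := by
  induction U using OrientedEq.unification_induction generalizing E K with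
  | nil =>
    obtain rfl : E = ∅ := Set.subset_empty_iff.1 (equations_nil ▸ hE)
    exact .of_empty (tidyQuery_iff.2 hU)
  | cons u U hdrop hbind hdecompose =>
    by_cases hu : u.eqn ∈ E
    swap
    · exact hdrop (subset_equations_of_notMem hE hu) (hU.of_sublist (List.sublist_cons_self _ _))
    have hdisjoint {x : V} (hout : x ∈ termVars u.out) (hinp : x ∈ termVars u.inp) : False :=
      hU.acyclic x (.single ⟨u.node, List.mem_cons_self, hinp, hout⟩)
    have hsubst {X : V} {t : L.Term V} (hX : X ∉ termVars t) (hXt : Binds u.eqn X t)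
        (htidy : TidyNodes ((U.map OrientedEq.node ++ K.map (Atom.node M)).map
          (IONode.bind fun x => termOccs (single X t x)))) : UnifiesTidily M E K := by
      refine .of_binds hu hXt hX (hbind X t hXt hX ?_ ?_)
      · rw [← image_subst_equations]
        exact Set.image_mono (sdiff_subset_equations hE (.inl rfl))
      · rwa [map_node_append_map_subst]
    obtain ⟨X, hout, hX⟩ | ⟨X, hinp, hX⟩ | ⟨n, f, s, t, b, rfl⟩ | hclash :=
      u.binds_or_decomposes_or_clash
    · refine hsubst (fun h => hdisjoint (hout ▸ mem_termVars_var.2 rfl) h) hX ?_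
      rw [List.map_cons, OrientedEq.node, hout, termOccs_var] at hU
      exact hU.eliminate_out (by rw [single_same]) fun _ => termOccs_single_of_ne u.inp
    · refine hsubst (fun h => hdisjoint h (hinp ▸ mem_termVars_var.2 rfl)) hX ?_
      rw [List.map_cons, OrientedEq.node, hinp, termOccs_var] at hU
      exact hU.eliminate_in (by rw [single_same]) fun _ => termOccs_single_of_ne u.out
    · refine .of_oriented_decompose hu (hdecompose n f s t b rfl ?_ ?_)
      · rw [equations_append]
        exact Set.union_subset_union_right _ (sdiff_subset_equations hE rfl)
      · rw [List.map_cons, OrientedEq.node, termOccs_func, termOccs_func] at hU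
        rw [List.map_append, argEqs, List.map_map, List.append_assoc]
        exact hU.split
    · exact .of_clash (hclash.mono (Set.singleton_subset_iff.2 hu))

theorem OrientedEq.unifies_func_iff {n : ℕ} {f : L.Functions n} {s t : Fin n → L.Term V} {b : Bool}
    {g : V → L.Term V} : (OrientedEq.eqn ⟨.func f s, .func f t, b⟩).Unifies g ↔
      UnifiesAll g (equations (argEqs s t b)) := by
  rw [equations_argEqs]
  cases b <;> exact Equation.unifies_func_iff

/-- After matching `E₁`, that is, solving it by a partial grounding, the remaining equations `E₂`
unify tidily with respect to `K`. -/
def MatchesTidily (M : Moding L) (E₁ E₂ : Set (Equation L V)) (K : Query L V) : Prop :=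
  ∀ σ : V → L.Term V, IsPartialGrounding σ → UnifiesAll σ E₁ →
    ∀ E ⊆ Equation.subst σ '' E₂, UnifiesTidily M E (querySubst K σ)

theorem MatchesTidily.unifiesTidily {M : Moding L} {E : Set (Equation L V)} {K : Query L V}
    (h : MatchesTidily M ∅ E K) : UnifiesTidily M E K := by
  have hvar := h .var (fun _ => .inl rfl) (fun e he => absurd he (Set.notMem_empty e)) E
    fun e he => ⟨e, he, e.subst_var⟩
  rwa [querySubst_var] at hvar

theorem MatchesTidily.image_subst_single {M : Moding L} {E₁ E₂ : Set (Equation L V)}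
    {K : Query L V} (h : MatchesTidily M E₁ E₂ K) {e : Equation L V} {X : V} {t : L.Term V}
    (het : Binds e X t) (ht : IsGround t) :
    MatchesTidily M (Equation.subst (single X t) '' (E₁ \ {e, .term (.var X) t}))
      (Equation.subst (single X t) '' (E₂ \ {e, .term (.var X) t}))
      (querySubst K (single X t)) := by
  intro σ hσ hσE₁ E hE
  rw [querySubst_querySubst]
  refine h _ ((isPartialGrounding_single ht).comp hσ) (fun e' he' => ?_) E (hE.trans ?_)
  · by_cases heR : e' ∈ ({e, .term (.var X) t} : Set (Equation L V))
    · have hX : (Equation.term (.var X) t).Unifies fun x => (single X t x).subst σ :=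
        unifies_single_subst (ht ▸ Set.notMem_empty X) σ
      exact heR.elim (fun h => h ▸ het.unifies_iff.2 hX) fun h => h ▸ hX
    · exact unifiesAll_image_subst.1 hσE₁ e' ⟨he', heR⟩
  · simp only [Set.image_image, Equation.subst_subst]
    exact Set.image_mono Set.sdiff_subset

theorem MatchesTidily.decompose {M : Moding L} {E₁ E₂ : Set (Equation L V)} {K : Query L V}
    (h : MatchesTidily M E₁ E₂ K) {n : ℕ} {f : L.Functions n} {s t : Fin n → L.Term V} {b : Bool}
    (he : OrientedEq.eqn ⟨.func f s, .func f t, b⟩ ∈ E₁) :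
    MatchesTidily M
      (equations (argEqs s t b) ∪ E₁ \ {OrientedEq.eqn ⟨.func f s, .func f t, b⟩})
      (E₂ \ {OrientedEq.eqn ⟨.func f s, .func f t, b⟩}) K := by
  intro σ hσ hσE₁ E hE
  rw [Set.union_comm, unifiesAll_sdiff_singleton_union he OrientedEq.unifies_func_iff] at hσE₁
  exact h σ hσ hσE₁ E (hE.trans (Set.image_mono Set.sdiff_subset))

theorem UnifiesTidily.of_matchesTidily {M : Moding L} {U : List (OrientedEq L V)} {K : Query L V}
    {E₁ E₂ : Set (Equation L V)} (hU : ∀ u ∈ U, IsGround u.inp) (hE₁ : E₁ ⊆ equations U)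
    (h : MatchesTidily M E₁ E₂ K) : UnifiesTidily M (E₁ ∪ E₂) K := by
  induction U using OrientedEq.unification_induction generalizing E₁ E₂ K with
  | nil =>
    obtain rfl : E₁ = ∅ := Set.subset_empty_iff.1 (equations_nil ▸ hE₁)
    rw [Set.empty_union]
    exact h.unifiesTidily
  | cons u U hdrop hbind hdecompose =>
    have hU' : ∀ w ∈ U, IsGround w.inp := fun w hw => hU w (List.mem_cons_of_mem _ hw)
    by_cases hu : u.eqn ∈ E₁
    swap
    · exact hdrop hU' (subset_equations_of_notMem hE₁ hu) h
    have hground : IsGround u.inp := hU u List.mem_cons_self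
    obtain ⟨X, -, hX⟩ | ⟨X, hinp, -⟩ | ⟨n, f, s, t, b, rfl⟩ | hclash :=
      u.binds_or_decomposes_or_clash
    · have hXt : X ∉ termVars u.inp := hground ▸ Set.notMem_empty X
      refine .of_binds (.inl hu) hX hXt ?_
      rw [Set.union_sdiff_distrib, Set.image_union]
      refine hbind X u.inp hX hXt (List.forall_mem_map.2 fun w hw => (hU' w hw).subst _) ?_
        (h.image_subst_single hX hground)
      rw [← image_subst_equations]
      exact Set.image_mono (sdiff_subset_equations hE₁ (.inl rfl))
    · rw [hinp, isGround_iff, termOccs_var] at hground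
      exact absurd hground (List.cons_ne_nil _ _)
    · refine .of_oriented_decompose (.inl hu) ?_
      rw [Set.union_sdiff_distrib, ← Set.union_assoc]
      refine hdecompose n f s t b rfl (fun w hw => ?_) ?_ (h.decompose hu)
      · obtain hw | hw := List.mem_append.1 hw
        · obtain ⟨i, -, rfl⟩ := List.mem_map.1 hw
          exact hground.args i
        · exact hU' w hw
      · rw [equations_append]
        exact Set.union_subset_union_right _ (sdiff_subset_equations hE₁ rfl)
    · exact .of_clash (hclash.mono (Set.singleton_subset_iff.2 (.inl hu)))

/-! ### Resolution -/

/-- The equations `a i ≐ h i` between the arguments of a selected atom and of a head. The head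
provides the input positions, hence the equations there are flipped. -/
def resolutionEqs {n : ℕ} (m : Fin n → Mode) (a h : Fin n → L.Term V) : List (OrientedEq L V) :=
  ((List.finRange n).filter fun i => m i = .output).map (fun i => ⟨a i, h i, false⟩) ++
    ((List.finRange n).filter fun i => m i = .input).map fun i => ⟨h i, a i, true⟩

theorem range_subset_equations_resolutionEqs {n : ℕ} (m : Fin n → Mode) (a h : Fin n → L.Term V) :
    (Set.range fun i => Equation.term (a i) (h i)) ⊆ equations (resolutionEqs m a h) := by
  rintro _ ⟨i, rfl⟩
  cases hi : m i with
  | input =>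
    exact ⟨⟨h i, a i, true⟩, List.mem_append_right _ (List.mem_map_of_mem (by simp [hi])), rfl⟩
  | output =>
    exact ⟨⟨a i, h i, false⟩, List.mem_append_left _ (List.mem_map_of_mem (by simp [hi])), rfl⟩

theorem TidyQuery.tidyNodes_resolutionEqs {M : Moding L} {Q₁ Q₂ B : Query L V} {n : ℕ}
    {p : L.Relations n} {a h : Fin n → L.Term V} (hQ : TidyQuery M (Q₁ ++ ⟨n, p, a⟩ :: Q₂))
    (hC : TidyClause M ⟨⟨n, p, h⟩, B⟩)
    (hdisj : Disjoint (queryVars (Q₁ ++ ⟨n, p, a⟩ :: Q₂)) (Clause.vars ⟨⟨n, p, h⟩, B⟩)) :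
    TidyNodes ((resolutionEqs (M n p) a h).map OrientedEq.node ++
      (Q₁ ++ B ++ Q₂).map (Atom.node M)) := by
  rw [← nodeVars_map_node M, ← nodeVars_clause_nodes M, List.map_append, List.map_cons] at hdisj
  rw [tidyQuery_iff, List.map_append, List.map_cons] at hQ
  have hresolve := hQ.resolve (tidyClause_iff.1 hC) hdisj
  simp only [Atom.node, outTerms, inTerms, List.flatMap_map] at hresolve
  have hsplit := (hresolve.split.of_perm List.perm_middle.symm).split
  rw [resolutionEqs, List.map_append, List.map_map, List.map_map, List.map_append, List.map_append,
    List.append_assoc]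
  exact hsplit

theorem UnifiesTidily.of_tidyClause {M : Moding L} {Q₁ Q₂ B : Query L V} {n : ℕ}
    {p : L.Relations n} {a h : Fin n → L.Term V} (hQ : TidyQuery M (Q₁ ++ ⟨n, p, a⟩ :: Q₂))
    (hC : TidyClause M ⟨⟨n, p, h⟩, B⟩)
    (hdisj : Disjoint (queryVars (Q₁ ++ ⟨n, p, a⟩ :: Q₂)) (Clause.vars ⟨⟨n, p, h⟩, B⟩))
    {E : Set (Equation L V)} (hE : E ⊆ Set.range fun i => .term (a i) (h i)) :
    UnifiesTidily M E (Q₁ ++ B ++ Q₂) :=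
  .of_tidyNodes (hE.trans (range_subset_equations_resolutionEqs _ a h))
    (hQ.tidyNodes_resolutionEqs hC hdisj)

theorem IsPartialGrounding.queryVars_querySubst_subset {f : V → L.Term V}
    (hf : IsPartialGrounding f) (Q : Query L V) : queryVars (querySubst Q f) ⊆ queryVars Q := by
  intro y hy
  obtain ⟨x, hx, hy⟩ := mem_queryVars_querySubst.1 hy
  exact List.mem_singleton.1 ((hf.termOccs_sublist x).subset hy) ▸ hx

theorem IsPartialGrounding.clause_vars_subst_subset {f : V → L.Term V}
    (hf : IsPartialGrounding f) (C : Clause L V) : (C.subst f).vars ⊆ C.vars := by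
  rintro y (hy | hy)
  · obtain ⟨x, hx, hy⟩ := Atom.mem_vars_subst.1 hy
    exact .inl (List.mem_singleton.1 ((hf.termOccs_sublist x).subset hy) ▸ hx)
  · exact .inr (hf.queryVars_querySubst_subset C.body hy)

theorem UnifiesTidily.of_weaklyTidyClause {M : ThreeModing L} {M' : Moding L} {Q₁ Q₂ : Query L V}
    {A : Atom L V} {C : Clause L V} (hQ : TidyQuery M' (Q₁ ++ A :: Q₂)) (hA : InputGround M A)
    (hC : WeaklyTidyClause M M' C) (hdisj : Disjoint (queryVars (Q₁ ++ A :: Q₂)) C.vars)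
    (hsym : A.symbol = C.head.symbol) : UnifiesTidily M' {.atom A C.head} (Q₁ ++ C.body ++ Q₂) := by
  obtain ⟨n, p, a⟩ := A
  obtain ⟨⟨_, _, h⟩, B⟩ := C
  cases hsym
  let U : List (OrientedEq L V) :=
    ((List.finRange n).filter fun i => M n p i = .input).map fun i => ⟨h i, a i, true⟩
  have hU_ground : ∀ u ∈ U, IsGround u.inp :=
    List.forall_mem_map.2 fun i hi => hA _ (List.mem_map_of_mem hi)
  have hU_range : equations U ⊆ Set.range fun i => Equation.term (a i) (h i) := by
    rintro _ ⟨u, hu, rfl⟩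
    obtain ⟨i, -, rfl⟩ := List.mem_map.1 hu
    exact ⟨i, rfl⟩
  refine .of_decomposeAtom ?_
  rw [← Set.union_eq_right.2 hU_range]
  refine .of_matchesTidily hU_ground subset_rfl fun σ hσ hσU E hE => ?_
  have hσC : ∀ x ∈ varIn3 M ⟨n, p, h⟩, IsGround (σ x) := by
    rintro x ⟨_, ht, hx⟩
    obtain ⟨i, hi, rfl⟩ := List.mem_map.1 ht
    have hha : (a i).subst σ = (h i).subst σ := hσU _ ⟨_, List.mem_map_of_mem hi, rfl⟩
    refine isGround_subst_iff.1 (hha ▸ ?_) x hx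
    exact (hA _ (List.mem_map_of_mem hi)).subst σ
  have hQσ := hQ.subst_of_isPartialGrounding hσ
  have hCσ := hC.tidyClause_subst hσ hσC
  have hdisjσ := hdisj.mono (hσ.queryVars_querySubst_subset _) (hσ.clause_vars_subst_subset _)
  rw [querySubst, List.map_append, List.map_cons] at hQσ hdisjσ
  rw [querySubst, List.map_append, List.map_append]
  refine .of_tidyClause hQσ hCσ hdisjσ (hE.trans ?_)
  rw [← Set.range_comp]
  rfl

/-! ### SLD-derivations -/

theorem UnifiesTidily.of_selected {M : ThreeModing L} {M' : Moding L} {P : Program L V}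
    (hP : WeaklyTidy M M' P) {Q : Query L V} {h : List (SLDStep L V)}
    (hQ : TidyQuery M' (lastQuery Q h)) {i : Fin (lastQuery Q h).length}
    (hi : InputGround M ((lastQuery Q h).get i)) {C : Clause L V} (hC : InputClause P Q h C)
    (hsym : ((lastQuery Q h).get i).symbol = C.head.symbol) :
    UnifiesTidily M' {.atom ((lastQuery Q h).get i) C.head}
      ((lastQuery Q h).take i ++ C.body ++ (lastQuery Q h).drop (i + 1)) := by
  obtain ⟨⟨D, hD, hCD⟩, -, hdisj, -⟩ := hC
  have hsplit : (lastQuery Q h).take i ++ (lastQuery Q h).get i :: (lastQuery Q h).drop (i + 1) =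
      lastQuery Q h := by
    rw [List.get_eq_getElem, ← List.drop_eq_getElem_cons, List.take_append_drop]
  have hC' : WeaklyTidyClause M M' C := .of_isVariant (hP D hD) hCD
  exact .of_weaklyTidyClause (hsplit.symm ▸ hQ) hi hC' (hsplit.symm ▸ hdisj.symm) hsym

/-- Every selected atom has its input positions ground: the part of `Compatible` that constrains
which atoms are selected, and not when an atom must be selected. -/
def SelectsInputGround (M : ThreeModing L) (P : Program L V) (Q : Query L V)
    (R : SelectionRule L V) : Prop :=
  ∀ h, Derivation P R Q h → ∀ i, R Q h = some i → InputGround M ((lastQuery Q h).get i)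

theorem Derivation.tidyQuery_lastQuery {M : ThreeModing L} {M' : Moding L} {P : Program L V}
    (hP : WeaklyTidy M M' P) {Q : Query L V} (hQ : TidyQuery M' Q) {R : SelectionRule L V}
    (hR : SelectsInputGround M P Q R) {h : List (SLDStep L V)} (hh : Derivation P R Q h) :
    TidyQuery M' (lastQuery Q h) := by
  induction hh with
  | nil => exact hQ
  | cons h i C θ hh hi hC hθ hlast =>
    have hsym := Atom.symbol_eq_of_subst_eq hθ.1
    exact (UnifiesTidily.of_selected hP hlast (hR h hh i hi) hC hsym).tidyQuery_of_isMGU hθ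

theorem weaklyOccurCheckFree_of_selectsInputGround {M : ThreeModing L} {M' : Moding L}
    {P : Program L V} (hP : WeaklyTidy M M' P) {Q : Query L V} (hQ : TidyQuery M' Q)
    {R : SelectionRule L V} (hR : SelectsInputGround M P Q R) : WeaklyOccurCheckFree P R Q := by
  rintro _ _ ⟨h, i, C, hh, hi, hC, rfl, rfl, hsym⟩
  have hlast := hh.tidyQuery_lastQuery hP hQ hR
  exact (UnifiesTidily.of_selected hP hlast (hR h hh i hi) hC hsym).wnsto_self

end OccurCheck

theorem mainTheorem10_general {L : FirstOrder.Language.{u, v}} {V : Type w}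
    (M : OccurCheck.ThreeModing L) (M' : OccurCheck.Moding L)
    (P : OccurCheck.Program L V) (hP : OccurCheck.WeaklyTidy M M' P)
    (Q : OccurCheck.Query L V) (hQ : OccurCheck.TidyQuery M' Q)
    (R : OccurCheck.SelectionRule L V) (hR : OccurCheck.SelectsInputGround M P Q R) :
    (∀ h, OccurCheck.Derivation P R Q h →
      OccurCheck.TidyQuery M' (OccurCheck.lastQuery Q h)) ∧
    OccurCheck.WeaklyOccurCheckFree P R Q :=
  ⟨fun _ hh => hh.tidyQuery_lastQuery hP hQ hR,
    OccurCheck.weaklyOccurCheckFree_of_selectsInputGround hP hQ hR⟩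

theorem mainTheorem10 {L : FirstOrder.Language.{u, v}} {V : Type w} [Infinite V]
    (M : OccurCheck.ThreeModing L) (M' : OccurCheck.Moding L)
    (P : OccurCheck.Program L V) (hP : OccurCheck.WeaklyTidy M M' P)
    (Q : OccurCheck.Query L V) (hQ : OccurCheck.TidyQuery M' Q)
    (R : OccurCheck.SelectionRule L V) (hR : OccurCheck.Compatible M P Q R) :
    (∀ h, OccurCheck.Derivation P R Q h →
      OccurCheck.TidyQuery M' (OccurCheck.lastQuery Q h)) ∧
    OccurCheck.WeaklyOccurCheckFree P R Q :=
  mainTheorem10_general M M' P hP Q hQ R fun h hh => (hR h hh).1
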